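/- Let $n\ge 2$ and let $\mathcal B_m$ denote Artin's braid group on $m$ strands, with Artin generators $\sigma_1,\dots,\sigma_{m-1}$. A \emph{tree pair} is a tuple $(T,\beta,\lambda,T')$, where $T,T'$ are finite full $n$-ary trees with the same number $m$ of leaves, $\beta\in\mathcal B_m$ is a braid from the leaves of $T$ to the leaves of $T'$ (both ordered from left to right), and $\lambda=\{\ell_1,\dots,\ell_m\}$ with $\ell_j\in\mathcal B_n$ is the label of the strand of $\beta$ that ends at the $j$-th leaf of $T'$. An \emph{expansion} of a tree pair at the $j$-th leaf of $T'$ appends a caret (a vertex with $n$ children) to this leaf and to the leaf of $T$ that $\beta$ connects with it, replaces the connecting strand by $n$ parallel strands followed by the braid $\ell_j$ on these $n$ strands, and gives the label $\ell_j$ to each of them; the other labels do not change. The group $BV_n(\mathcal B_n)$ consists of the tree pairs modulo the equivalence relation generated by expansions. Its product is given by $(T,\beta,\lambda,T')(T',\beta',\lambda',T'')=(T,\beta\beta',\lambda'',T'')$, where the label $\lambda''$ of a strand is the product of the labels in $\lambda$ and $\lambda'$ along it (any two elements have representatives that can be composed in this way). The \emph{depth} of a tree is the number of its carets. For a tree $T$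 with leaf $w$ let $T[w]$ be $T$ with a caret appended to $w$, where vertices are words in $\{0,\dots,n-1\}$. Let $R$ be the tree of depth $1$, and let $T(n)=R[0][1][00][01]$ if $n=2$ and $T(n)=R[0][1][2]$ if $n>2$. Let $m(n)$ be the number of leaves of $T(n)$, and let $\overrightarrow{Id}$ denote trivial labels. Then $BV_n(\mathcal B_n)$ is finitely generated. More precisely, it is generated by the elements that are represented by the following tree pairs, of which there are finitely many: \begin{itemize} \item $e_T=(T,Id,\overrightarrow{Id},T(n))$, for the trees $T$ with $m(n)$ leaves; \item $h_i=(T(n),\sigma_i,\overrightarrow{Id},T(n))$, for $1\le i\le m(n)-1$, where $\sigma_i\in\mathcal B_{m(n)}$; \item $g_j=(R,Id,\{\sigma_j,Id,\dots,Id\},R)$, for $1\le j\le n-1$, where $\sigma_j\in\mathcal B_n$. \end{itemize} All trees in these tree pairs have depth at most $5$, and at most $4$ if $n\ge 3$. -/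

import Mathlib

namespace BraidedThompson

/-! Braid groups -/

/-- Artin's relations for the braid group on `m` strands. The generator with index `i : Fin (m - 1)`
(counting from `0`) crosses the strand in position `i` over the strand in position `i + 1`. -/
def artinRels (m : ℕ) : Set (FreeGroup (Fin (m - 1))) :=
  {r | ∃ i j : Fin (m - 1), (i : ℕ) + 1 < j ∧
      r = FreeGroup.of i * FreeGroup.of j * (FreeGroup.of j * FreeGroup.of i)⁻¹} ∪
  {r | ∃ i j : Fin (m - 1), (i : ℕ) + 1 = j ∧
      r = FreeGroup.of i * FreeGroup.of j * FreeGroup.of i *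
        (FreeGroup.of j * FreeGroup.of i * FreeGroup.of j)⁻¹}

/-- The braid group on `m` strands, by Artin's presentation. Products are read from left to right
as braids from top to bottom. -/
abbrev Braid (m : ℕ) : Type := PresentedGroup (artinRels m)

/-- The Artin generators. -/
def artin {m : ℕ} (i : Fin (m - 1)) : Braid m := PresentedGroup.of i

/-- The Artin generators with an index in `ℕ`, with value `1` out of range. -/
def sg (m : ℕ) (i : ℕ) : Braid m := if h : i < m - 1 then artin ⟨i, h⟩ else 1

theorem sg_val {m : ℕ} (i : Fin (m - 1)) : sg m i = artin i := by simp [sg]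

/-- A sequence of elements of a group whose first `M` members satisfy the braid relations. -/
structure BraidSeq {G : Type*} [Group G] (M : ℕ) (s : ℕ → G) : Prop where
  far : ∀ i j, i + 1 < j → s i * s j = s j * s i
  braid : ∀ i, i + 1 < M → s i * s (i + 1) * s i = s (i + 1) * s i * s (i + 1)

theorem braidSeq_sg (m : ℕ) : BraidSeq (m - 1) (sg m) := by
  constructor
  · intro i j hij
    by_cases hj : j < m - 1
    · have hi : i < m - 1 := by omega
      have h := PresentedGroup.one_of_mem (rels := artinRels m)
        (x := FreeGroup.of ⟨i, hi⟩ * FreeGroup.of ⟨j, hj⟩ *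
          (FreeGroup.of ⟨j, hj⟩ * FreeGroup.of ⟨i, hi⟩)⁻¹) (Or.inl ⟨_, _, hij, rfl⟩)
      rw [map_mul, map_inv, mul_inv_eq_one] at h
      simpa [sg, hi, hj, artin, PresentedGroup.of] using h
    · simp [sg, hj]
  · intro i hi
    have hi' : i < m - 1 := by omega
    have h := PresentedGroup.one_of_mem (rels := artinRels m)
        (x := FreeGroup.of ⟨i, hi'⟩ * FreeGroup.of ⟨i + 1, hi⟩ * FreeGroup.of ⟨i, hi'⟩ *
          (FreeGroup.of ⟨i + 1, hi⟩ * FreeGroup.of ⟨i, hi'⟩ * FreeGroup.of ⟨i + 1, hi⟩)⁻¹)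
        (Or.inr ⟨_, _, rfl, rfl⟩)
    rw [map_mul, map_inv, mul_inv_eq_one] at h
    simpa [sg, hi, hi', artin, PresentedGroup.of] using h

/-- A homomorphism out of the braid group, from values that satisfy the braid relations. -/
def Braid.lift {G : Type*} [Group G] {m : ℕ} (f : Fin (m - 1) → G)
    (far : ∀ i j : Fin (m - 1), (i : ℕ) + 1 < j → f i * f j = f j * f i)
    (braid : ∀ i j : Fin (m - 1), (i : ℕ) + 1 = j → f i * f j * f i = f j * f i * f j) :
    Braid m →* G :=
  PresentedGroup.toGroup (f := f) (by
    rintro r (⟨i, j, h, rfl⟩ | ⟨i, j, h, rfl⟩)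
    · simpa [mul_inv_eq_one, ← mul_inv_rev] using mul_inv_eq_one.2 (far i j h)
    · simpa [mul_inv_eq_one, ← mul_inv_rev, mul_assoc] using mul_inv_eq_one.2 (braid i j h))

@[simp] theorem Braid.lift_artin {G : Type*} [Group G] {m : ℕ} (f : Fin (m - 1) → G) (far) (braid)
    (i : Fin (m - 1)) : Braid.lift f far braid (artin i) = f i :=
  PresentedGroup.toGroup.of _

theorem Braid.induct {m : ℕ} {P : Braid m → Prop} (x : Braid m) (one : P 1)
    (gen : ∀ i, P (artin i)) (mul : ∀ x y, P x → P y → P (x * y)) (inv : ∀ x, P x → P x⁻¹) :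
    P x := by
  have hx : x ∈ Subgroup.closure (Set.range (PresentedGroup.of (rels := artinRels m))) := by
    rw [PresentedGroup.closure_range_of]; trivial
  induction hx using Subgroup.closure_induction with
  | mem x h => obtain ⟨i, rfl⟩ := h; exact gen i
  | one => exact one
  | mul x y _ _ hx hy => exact mul x y hx hy
  | inv x _ hx => exact inv x hx

theorem swap_val {m : ℕ} {i : ℕ} (h0 : i < m) (h : i + 1 < m) (k : Fin m) :
    (Equiv.swap (⟨i, h0⟩ : Fin m) ⟨i + 1, h⟩ k : ℕ) =
      if (k : ℕ) = i then i + 1 else if (k : ℕ) = i + 1 then i else k := by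
  rw [Equiv.swap_apply_def]
  simp only [Fin.ext_iff]
  split_ifs <;> rfl

/-- The permutation of a braid: the strand which ends in position `j` starts in
position `perm β j`. -/
def perm {m : ℕ} : Braid m →* Equiv.Perm (Fin m) :=
  Braid.lift (fun i => Equiv.swap ⟨i, by omega⟩ ⟨i + 1, by omega⟩)
    (by
      intro i j h; ext k
      simp only [Equiv.Perm.coe_mul, Function.comp_apply, swap_val]
      split_ifs <;> omega)
    (by
      rintro ⟨i, hi⟩ ⟨j, hj⟩ h; ext k
      obtain rfl : i + 1 = j := h
      simp only [Equiv.Perm.coe_mul, Function.comp_apply, swap_val]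
      split_ifs <;> omega)

theorem perm_artin {m : ℕ} (i : Fin (m - 1)) (k : Fin m) :
    (perm (artin i) k : ℕ) =
      if (k : ℕ) = i then (i : ℕ) + 1 else if (k : ℕ) = i + 1 then (i : ℕ) else k := by
  rw [perm, Braid.lift_artin, swap_val]

/-! Words in a braid sequence -/

section Words

variable {G : Type*} [Group G] {M : ℕ} {s : ℕ → G}

/-- `s a * s (a + 1) * ⋯ * s (a + k - 1)` -/
def asc (s : ℕ → G) (a : ℕ) : ℕ → G
  | 0 => 1
  | k + 1 => asc s a k * s (a + k)

/-- `s (a + k - 1) * ⋯ * s (a + 1) * s a` -/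
def desc (s : ℕ → G) (a : ℕ) : ℕ → G
  | 0 => 1
  | k + 1 => s (a + k) * desc s a k

theorem asc_add (a k l : ℕ) : asc s a (k + l) = asc s a k * asc s (a + k) l := by
  induction l with
  | zero => simp [asc]
  | succ l ih => rw [← add_assoc, asc, ih, asc, mul_assoc, add_assoc]

theorem desc_add (a k l : ℕ) : desc s a (k + l) = desc s (a + k) l * desc s a k := by
  induction l with
  | zero => simp [desc]
  | succ l ih => rw [← add_assoc, desc, ih, desc, mul_assoc, add_assoc]

theorem asc_succ' (a k : ℕ) : asc s a (k + 1) = s a * asc s (a + 1) k := by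
  rw [add_comm k, asc_add]; simp [asc]

theorem desc_succ' (a k : ℕ) : desc s a (k + 1) = desc s (a + 1) k * s a := by
  rw [add_comm k, desc_add]; simp [desc]

theorem BraidSeq.comm (hs : BraidSeq M s) {i j : ℕ} (h : i + 1 < j ∨ j + 1 < i) :
    Commute (s i) (s j) := by
  rcases h with h | h
  · exact hs.far i j h
  · exact (hs.far j i h).symm

theorem BraidSeq.comm_asc (hs : BraidSeq M s) {j a k : ℕ} (h : j + 1 < a ∨ a + k < j) :
    Commute (s j) (asc s a k) := by
  induction k with
  | zero => exact Commute.one_right _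
  | succ k ih => exact (ih (by omega)).mul_right (hs.comm (by omega))

theorem BraidSeq.comm_desc (hs : BraidSeq M s) {j a k : ℕ} (h : j + 1 < a ∨ a + k < j) :
    Commute (s j) (desc s a k) := by
  induction k with
  | zero => exact Commute.one_right _
  | succ k ih => exact (hs.comm (by omega)).mul_right (ih (by omega))

theorem BraidSeq.asc_slide (hs : BraidSeq M s) {j a k : ℕ} (h1 : a ≤ j) (h2 : j + 1 < a + k)
    (h3 : a + k ≤ M) : asc s a k * s j = s (j + 1) * asc s a k := by
  obtain ⟨p, rfl⟩ := Nat.exists_eq_add_of_le h1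
  obtain ⟨q, rfl⟩ := Nat.exists_eq_add_of_le (show p + 2 ≤ k by omega)
  have e : asc s a (p + 2 + q) =
      asc s a p * (s (a + p) * s (a + p + 1)) * asc s (a + p + 2) q := by
    rw [asc_add, asc_add]; simp [asc, add_assoc]
  have c1 := hs.comm_asc (j := a + p) (a := a + p + 2) (k := q) (by omega)
  have c2 := hs.comm_asc (j := a + p + 1) (a := a) (k := p) (by omega)
  have b := hs.braid (a + p) (by omega)
  calc asc s a (p + 2 + q) * s (a + p)
      = asc s a p * (s (a + p) * s (a + p + 1)) * (asc s (a + p + 2) q * s (a + p)) := by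
        rw [e]; group
    _ = asc s a p * (s (a + p) * s (a + p + 1) * s (a + p)) * asc s (a + p + 2) q := by
        rw [← c1.eq]; group
    _ = (asc s a p * s (a + p + 1)) * (s (a + p) * s (a + p + 1)) * asc s (a + p + 2) q := by
        rw [b]; group
    _ = _ := by rw [← c2.eq, e]; group

theorem BraidSeq.desc_slide (hs : BraidSeq M s) {j a k : ℕ} (h1 : a ≤ j) (h2 : j + 1 < a + k)
    (h3 : a + k ≤ M) : s j * desc s a k = desc s a k * s (j + 1) := by
  obtain ⟨p, rfl⟩ := Nat.exists_eq_add_of_le h1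
  obtain ⟨q, rfl⟩ := Nat.exists_eq_add_of_le (show p + 2 ≤ k by omega)
  have e : desc s a (p + 2 + q) =
      desc s (a + p + 2) q * (s (a + p + 1) * s (a + p)) * desc s a p := by
    rw [desc_add, desc_add]; simp [desc, add_assoc, mul_assoc]
  have c1 := hs.comm_desc (j := a + p) (a := a + p + 2) (k := q) (by omega)
  have c2 := hs.comm_desc (j := a + p + 1) (a := a) (k := p) (by omega)
  have b := hs.braid (a + p) (by omega)
  calc s (a + p) * desc s a (p + 2 + q)
      = (s (a + p) * desc s (a + p + 2) q) * (s (a + p + 1) * s (a + p)) * desc s a p := by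
        rw [e]; group
    _ = desc s (a + p + 2) q * (s (a + p) * s (a + p + 1) * s (a + p)) * desc s a p := by
        rw [c1.eq]; group
    _ = desc s (a + p + 2) q * (s (a + p + 1) * s (a + p)) * (s (a + p + 1) * desc s a p) := by
        rw [b]; group
    _ = _ := by rw [c2.eq, e]; group

theorem BraidSeq.asc_asc (hs : BraidSeq M s) {a b k : ℕ} (h1 : a ≤ b) :
    ∀ {l : ℕ}, b + l < a + k → a + k ≤ M →
      asc s a k * asc s b l = asc s (b + 1) l * asc s a k
  | 0, _, _ => by simp [asc]
  | l + 1, h2, h3 => by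
    rw [asc, ← mul_assoc, hs.asc_asc h1 (l := l) (by omega) h3, mul_assoc,
      hs.asc_slide (by omega) (by omega) h3, asc, mul_assoc, add_right_comm]

theorem BraidSeq.desc_desc (hs : BraidSeq M s) {a b k : ℕ} (h1 : a ≤ b) :
    ∀ {l : ℕ}, b + l < a + k → a + k ≤ M →
      desc s b l * desc s a k = desc s a k * desc s (b + 1) l
  | 0, _, _ => by simp [desc]
  | l + 1, h2, h3 => by
    rw [desc, mul_assoc, hs.desc_desc h1 (l := l) (by omega) h3, ← mul_assoc,
      hs.desc_slide (by omega) (by omega) h3, desc, mul_assoc, add_right_comm]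

theorem BraidSeq.asc_desc_comm (hs : BraidSeq M s) {a k b l : ℕ}
    (h : a + k < b ∨ b + l < a) : Commute (asc s a k) (asc s b l) ∧
      Commute (asc s a k) (desc s b l) ∧ Commute (desc s a k) (asc s b l) ∧
      Commute (desc s a k) (desc s b l) := by
  induction k with
  | zero => simp [asc, desc]
  | succ k ih =>
    obtain ⟨i1, i2, i3, i4⟩ := ih (by omega)
    have c1 := hs.comm_asc (j := a + k) (a := b) (k := l) (by omega)
    have c2 := hs.comm_desc (j := a + k) (a := b) (k := l) (by omega)
    exact ⟨i1.mul_left c1, i2.mul_left c2, c1.mul_left i3, c2.mul_left i4⟩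

end Words

section Words

variable {G : Type*} [Group G] {M : ℕ} {s : ℕ → G}

theorem BraidSeq.asc_desc (hs : BraidSeq M s) {a b k : ℕ} (h1 : a ≤ b) :
    ∀ {l : ℕ}, b + l < a + k → a + k ≤ M →
      asc s b l * desc s a k = desc s a k * asc s (b + 1) l
  | 0, _, _ => by simp [asc]
  | l + 1, h2, h3 => by
    rw [asc, mul_assoc, hs.desc_slide (by omega) (by omega) h3, ← mul_assoc,
      hs.asc_desc h1 (l := l) (by omega) h3, asc, mul_assoc, add_right_comm]

/-- The transposition of `i` and `i + 1`. -/
def sw (i k : ℕ) : ℕ := if k = i then i + 1 else if k = i + 1 then i else k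

/-- The word obtained from the crossing of the strands `i` and `i + 1` when the strand which ends
in position `j` is replaced by `N + 1` parallel strands. -/
def cableWord (s : ℕ → G) (N i j : ℕ) : G :=
  if j < i then s (i + N)
  else if j = i then asc s i (N + 1)
  else if j = i + 1 then desc s i (N + 1)
  else s i

theorem sw_of_lt {i k : ℕ} (h : k < i) : sw i k = k := by unfold sw; split_ifs <;> omega
theorem sw_of_gt {i k : ℕ} (h : i + 1 < k) : sw i k = k := by unfold sw; split_ifs <;> omega
@[simp] theorem sw_self {i : ℕ} : sw i i = i + 1 := by simp [sw]
@[simp] theorem sw_succ {i : ℕ} : sw i (i + 1) = i := by simp [sw]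

theorem cableWord_lt {N i j : ℕ} (h : j < i) : cableWord s N i j = s (i + N) := by
  simp [cableWord, h]
theorem cableWord_gt {N i j : ℕ} (h : i + 1 < j) : cableWord s N i j = s i := by
  unfold cableWord; split_ifs <;> first | omega | rfl
@[simp] theorem cableWord_self {N i : ℕ} : cableWord s N i i = asc s i (N + 1) := by
  simp [cableWord]
@[simp] theorem cableWord_succ {N i : ℕ} : cableWord s N i (i + 1) = desc s i (N + 1) := by
  simp [cableWord]

theorem BraidSeq.cable_far (hs : BraidSeq M s) (N : ℕ) {i i' : ℕ} (h : i + 1 < i') (j : ℕ) :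
    cableWord s N i (sw i' j) * cableWord s N i' j =
      cableWord s N i' (sw i j) * cableWord s N i j := by
  rcases lt_trichotomy j i with h1 | rfl | h1
  · rw [sw_of_lt (by omega), sw_of_lt h1, cableWord_lt h1, cableWord_lt (by omega)]
    exact hs.comm (by omega)
  · rw [sw_of_lt (by omega), sw_self, cableWord_self, cableWord_lt (by omega), cableWord_lt h]
    exact (hs.comm_asc (by omega)).symm
  rcases eq_or_ne j (i + 1) with rfl | h2
  · rw [sw_of_lt (by omega), sw_succ, cableWord_succ, cableWord_lt (by omega),
      cableWord_lt (by omega)]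
    exact (hs.comm_desc (by omega)).symm
  rw [sw_of_gt (i := i) (by omega), cableWord_gt (i := i) (j := j) (by omega)]
  rcases lt_trichotomy j i' with h3 | rfl | h3
  · rw [sw_of_lt (by omega), cableWord_lt h3, cableWord_gt (by omega)]
    exact hs.comm (by omega)
  · rw [sw_self, cableWord_self, cableWord_gt (by omega)]
    exact hs.comm_asc (by omega)
  rcases eq_or_ne j (i' + 1) with rfl | h4
  · rw [sw_succ, cableWord_succ, cableWord_gt (by omega)]
    exact hs.comm_desc (by omega)
  · rw [sw_of_gt (by omega), cableWord_gt (by omega), cableWord_gt (by omega)]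
    exact hs.comm (by omega)

theorem BraidSeq.cable_braid (hs : BraidSeq M s) {N i : ℕ} (h : i + 1 + N < M) (j : ℕ) :
    cableWord s N i (sw (i + 1) (sw i j)) * cableWord s N (i + 1) (sw i j) * cableWord s N i j =
      cableWord s N (i + 1) (sw i (sw (i + 1) j)) * cableWord s N i (sw (i + 1) j) *
        cableWord s N (i + 1) j := by
  rcases lt_trichotomy j i with h1 | rfl | h1
  · have b := hs.braid (i + N) (by omega)
    rw [sw_of_lt h1, sw_of_lt (i := i + 1) (by omega), sw_of_lt h1, cableWord_lt h1,
      cableWord_lt (by omega), add_right_comm i 1 N]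
    exact b
  · have e := hs.asc_asc (a := j) (b := j) (k := N + 2) (l := N + 1) le_rfl (by omega) (by omega)
    rw [sw_self, sw_self, sw_of_lt (i := j + 1) (by omega), sw_self, cableWord_gt (by omega),
      cableWord_self, cableWord_self, cableWord_lt (by omega), ← asc_succ', e, show asc s j (N + 2) = asc s j (N + 1) * s (j + (N + 1)) from rfl,
      ← mul_assoc]
    congr 2; omega
  rcases eq_or_ne j (i + 1) with rfl | h2
  · have e := hs.asc_desc (a := i) (b := i) (k := N + 2) (l := N + 1) le_rfl (by omega) (by omega)
    rw [sw_succ, sw_of_lt (i := i + 1) (by omega), sw_self, sw_of_gt (by omega),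
      cableWord_self, cableWord_self, cableWord_succ, cableWord_succ, cableWord_lt (by omega),
      cableWord_gt (by omega), ← desc_succ', ← e, mul_assoc,
      show desc s i (N + 2) = s (i + (N + 1)) * desc s i (N + 1) from rfl]
    congr 3; omega
  rcases eq_or_ne j (i + 2) with rfl | h3
  · have e := hs.desc_desc (a := i) (b := i) (k := N + 2) (l := N + 1) le_rfl (by omega) (by omega)
    rw [sw_of_gt (i := i) (k := i + 2) (by omega), show i + 2 = i + 1 + 1 from rfl, sw_succ,
      sw_succ, cableWord_succ, cableWord_succ, cableWord_gt (by omega), cableWord_lt (by omega),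
      mul_assoc, ← desc_succ', e,
      show desc s i (N + 2) = s (i + (N + 1)) * desc s i (N + 1) from rfl]
    simp only [mul_assoc]
    congr 2; omega
  · rw [sw_of_gt (i := i) (by omega), sw_of_gt (i := i + 1) (by omega), sw_of_gt (i := i) (by omega),
      cableWord_gt (by omega), cableWord_gt (by omega)]
    exact hs.braid i (by omega)

end Words

theorem perm_artin' {m : ℕ} (i : Fin (m - 1)) (k : Fin m) : (perm (artin i) k : ℕ) = sw i k :=
  perm_artin i k

theorem perm_sg {m i : ℕ} (h : i < m - 1) (k : Fin m) : (perm (sg m i) k : ℕ) = sw i k := by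
  rw [sg, dif_pos h, perm_artin']

theorem perm_inv {m : ℕ} (x : Braid m) (k : Fin m) : perm x (perm x⁻¹ k) = k := by
  rw [← Equiv.Perm.mul_apply, ← map_mul]; simp

theorem perm_inv' {m : ℕ} (x : Braid m) (k : Fin m) : perm x⁻¹ (perm x k) = k := by
  rw [← Equiv.Perm.mul_apply, ← map_mul]; simp

/-- The action of braids on `Fin m × Braid (m + N)` that defines the cabling. -/
def cableAct {m : ℕ} (N : ℕ) : Braid m →* Equiv.Perm (Fin m × Braid (m + N)) :=
  Braid.lift
    (fun i =>
      { toFun := fun p => (perm (artin i) p.1, cableWord (sg (m + N)) N i p.1 * p.2)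
        invFun := fun p => (perm (artin i)⁻¹ p.1,
          (cableWord (sg (m + N)) N i (perm (artin i)⁻¹ p.1 : Fin m))⁻¹ * p.2)
        left_inv := fun p => by simp
        right_inv := fun p => by simp })
    (by
      rintro i j h
      refine Equiv.ext fun p => Prod.ext ?_ ?_
      · apply Fin.ext
        simp only [Equiv.Perm.coe_mul, Function.comp_apply, Equiv.coe_fn_mk, perm_artin', sw]
        split_ifs <;> omega
      · simp only [Equiv.Perm.coe_mul, Function.comp_apply, Equiv.coe_fn_mk, ← mul_assoc,
          perm_artin', (braidSeq_sg (m + N)).cable_far N h])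
    (by
      rintro ⟨i, hi⟩ ⟨j, hj⟩ h
      obtain rfl : i + 1 = j := h
      refine Equiv.ext fun p => Prod.ext ?_ ?_
      · apply Fin.ext
        simp only [Equiv.Perm.coe_mul, Function.comp_apply, Equiv.coe_fn_mk, perm_artin', sw]
        split_ifs <;> omega
      · simp only [Equiv.Perm.coe_mul, Function.comp_apply, Equiv.coe_fn_mk, ← mul_assoc,
          perm_artin', (braidSeq_sg (m + N)).cable_braid (N := N) (i := i) (by omega)])

/-- `cable N j β` is the braid obtained from `β` when the strand which ends in position `j` is
replaced by `N + 1` parallel strands. -/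
def cable {m : ℕ} (N : ℕ) (j : Fin m) (β : Braid m) : Braid (m + N) := (cableAct N β (j, 1)).2

theorem cableAct_apply {m : ℕ} (N : ℕ) (β : Braid m) (p : Fin m × Braid (m + N)) :
    cableAct N β p = (perm β p.1, cable N p.1 β * p.2) := by
  unfold cable
  induction β using Braid.induct generalizing p with
  | one => simp
  | gen i => simp [cableAct]
  | mul x y hx hy =>
    have h1 := hx (cableAct N y p)
    have h2 := hx (cableAct N y (p.1, 1))
    have h3 := hy p
    have h4 : (cableAct N y (p.1, 1)).1 = perm y p.1 := by rw [hy]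
    have h5 : (cableAct N y p).1 = perm y p.1 := by rw [hy]
    rw [h5] at h1
    rw [h4] at h2
    simp only [map_mul, Equiv.Perm.mul_apply]
    rw [h1, h2, h3]
    simp only [mul_assoc]
  | inv x hx =>
    rw [map_inv, Equiv.Perm.inv_eq_iff_eq, hx]
    have h : cableAct N x ((cableAct N x)⁻¹ (p.1, 1)) = (p.1, 1) := by simp
    set q := (cableAct N x)⁻¹ (p.1, 1) with hq
    rw [hx q] at h
    obtain ⟨h1, h2⟩ := Prod.ext_iff.1 h
    have h3 : perm x⁻¹ p.1 = q.1 := by rw [← h1]; simp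
    ext1
    · simp
    · simp only [h3, ← mul_assoc] at h2 ⊢
      rw [h2]; simp

@[simp] theorem cable_one {m : ℕ} (N : ℕ) (j : Fin m) : cable N j 1 = 1 := by simp [cable]

theorem cable_mul {m : ℕ} (N : ℕ) (j : Fin m) (x y : Braid m) :
    cable N j (x * y) = cable N (perm y j) x * cable N j y := by
  rw [cable, map_mul, Equiv.Perm.mul_apply, cableAct_apply, cableAct_apply]; simp

theorem cable_artin {m : ℕ} (N : ℕ) (j : Fin m) (i : Fin (m - 1)) :
    cable N j (artin i) = cableWord (sg (m + N)) N i j := by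
  simp [cable, cableAct]

/-- `ins m n j h` is the braid `h` on the `n` strands in the positions `j, …, j + n - 1`. -/
def ins (m n : ℕ) (j : Fin m) : Braid n →* Braid (m + (n - 1)) :=
  Braid.lift (fun i => sg (m + (n - 1)) (j + i))
    (fun i i' h => (braidSeq_sg (m + (n - 1))).far _ _ (by omega))
    (fun i i' h => by
      rw [← h]; exact (braidSeq_sg (m + (n - 1))).braid _ (by omega))

@[simp] theorem ins_artin (m n : ℕ) (j : Fin m) (i) : ins m n j (artin i) = sg (m + (n - 1)) (j + i) := by
  simp [ins]

theorem ins_cable_artin {m n : ℕ} (j : Fin m) (i : Fin (m - 1)) (h : Braid n) :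
    ins m n (perm (artin i) j) h * cable (n - 1) j (artin i) =
      cable (n - 1) j (artin i) * ins m n j h := by
  have hs := braidSeq_sg (m + (n - 1))
  induction h using Braid.induct with
  | one => simp
  | gen k =>
    have hp := perm_artin' i j
    have hk : (k : ℕ) < n - 1 := k.2
    rw [ins_artin, ins_artin, cable_artin, hp]
    rcases lt_trichotomy (j : ℕ) i with h1 | h1 | h1
    · rw [sw_of_lt h1, cableWord_lt h1]
      exact hs.comm (by omega)
    · rw [h1, sw_self, cableWord_self, hs.asc_slide (by omega) (by omega) (by omega)]
      congr 2; omega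
    rcases eq_or_ne (j : ℕ) (i + 1) with h2 | h2
    · rw [h2, sw_succ, cableWord_succ, hs.desc_slide (by omega) (by omega) (by omega)]
      congr 2; omega
    · rw [sw_of_gt (by omega), cableWord_gt (by omega)]
      exact hs.comm (by omega)
  | mul x y hx hy => rw [map_mul, mul_assoc, hy, ← mul_assoc, hx, map_mul, mul_assoc]
  | inv x hx =>
    rw [map_inv, map_inv, inv_mul_eq_iff_eq_mul, ← mul_assoc, hx]; simp

theorem ins_cable {m n : ℕ} (j : Fin m) (β : Braid m) (h : Braid n) :
    ins m n (perm β j) h * cable (n - 1) j β = cable (n - 1) j β * ins m n j h := by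
  induction β using Braid.induct generalizing j with
  | one => simp
  | gen i => exact ins_cable_artin j i h
  | mul x y hx hy =>
    rw [cable_mul, map_mul, Equiv.Perm.mul_apply, ← mul_assoc, hx, mul_assoc, hy, mul_assoc]
  | inv x hx =>
    have e := hx (perm x⁻¹ j)
    have c := cable_mul (n - 1) j x x⁻¹
    rw [perm_inv] at e
    rw [mul_inv_cancel, cable_one] at c
    rw [← inv_eq_of_mul_eq_one_right c.symm, mul_inv_eq_iff_eq_mul, mul_assoc, e]
    simp

/-- The map that collapses the positions `j, …, j + N` to `j`. -/
def collapse {m : ℕ} (N : ℕ) (j : Fin m) (k : Fin (m + N)) : Fin m :=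
  if h : (k : ℕ) < j then ⟨k, by omega⟩
  else if h' : (k : ℕ) ≤ j + N then j
  else ⟨k - N, by omega⟩

theorem collapse_val {m : ℕ} (N : ℕ) (j : Fin m) (k : Fin (m + N)) :
    (collapse N j k : ℕ) = if (k : ℕ) < j then (k : ℕ) else if (k : ℕ) ≤ j + N then j else k - N := by
  unfold collapse; split_ifs <;> rfl

theorem perm_asc {m a k : ℕ} (h : a + k < m) (x : Fin m) :
    (perm (asc (sg m) a k) x : ℕ) =
      if (x : ℕ) = a + k then a else if a ≤ x ∧ (x : ℕ) < a + k then x + 1 else x := by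
  induction k generalizing x with
  | zero => simp only [asc, map_one, Equiv.Perm.one_apply]; split_ifs <;> omega
  | succ k ih =>
    rw [asc, map_mul, Equiv.Perm.mul_apply, ih (by omega), perm_sg (by omega)]
    unfold sw; split_ifs <;> omega

theorem perm_desc {m a k : ℕ} (h : a + k < m) (x : Fin m) :
    (perm (desc (sg m) a k) x : ℕ) =
      if (x : ℕ) = a then a + k else if a < x ∧ (x : ℕ) ≤ a + k then x - 1 else x := by
  induction k generalizing x with
  | zero => simp only [desc, map_one, Equiv.Perm.one_apply]; split_ifs <;> omega
  | succ k ih =>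
    rw [desc, map_mul, Equiv.Perm.mul_apply, perm_sg (by omega), ih (by omega)]
    unfold sw; split_ifs <;> omega

theorem collapse_cable {m N : ℕ} (j : Fin m) (β : Braid m) (k : Fin (m + N)) :
    collapse N (perm β j) (perm (cable N j β) k) = perm β (collapse N j k) := by
  induction β using Braid.induct generalizing j k with
  | one => simp
  | gen i =>
    have hi := i.2
    apply Fin.ext
    rw [cable_artin, perm_artin', collapse_val, collapse_val, perm_artin']
    rcases lt_trichotomy (j : ℕ) i with h1 | h1 | h1
    · rw [sw_of_lt h1, cableWord_lt h1, perm_sg (by omega)]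
      unfold sw; split_ifs <;> omega
    · rw [h1, sw_self, cableWord_self, perm_asc (by omega)]
      unfold sw; split_ifs <;> omega
    rcases eq_or_ne (j : ℕ) (i + 1) with h2 | h2
    · rw [h2, sw_succ, cableWord_succ, perm_desc (by omega)]
      unfold sw; split_ifs <;> omega
    · rw [sw_of_gt (by omega), cableWord_gt (by omega), perm_sg (by omega)]
      unfold sw; split_ifs <;> omega
  | mul x y hx hy =>
    rw [cable_mul, map_mul, Equiv.Perm.mul_apply, map_mul, Equiv.Perm.mul_apply,
      Equiv.Perm.mul_apply, hx, hy]
  | inv x hx =>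
    have c := cable_mul N j x x⁻¹
    rw [mul_inv_cancel, cable_one] at c
    rw [← inv_eq_of_mul_eq_one_right c.symm]
    apply (perm x).injective
    rw [← hx, perm_inv, perm_inv, perm_inv]

theorem collapse_ins {m n : ℕ} (j : Fin m) (h : Braid n) (k : Fin (m + (n - 1))) :
    collapse (n - 1) j (perm (ins m n j h) k) = collapse (n - 1) j k := by
  induction h using Braid.induct generalizing k with
  | one => simp
  | gen i =>
    have hi := i.2
    apply Fin.ext
    rw [ins_artin, collapse_val, collapse_val, perm_sg (by omega)]
    unfold sw; split_ifs <;> omega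
  | mul x y hx hy => rw [map_mul, map_mul, Equiv.Perm.mul_apply, hx, hy]
  | inv x hx => rw [map_inv, ← hx, perm_inv]

section Words

variable {G : Type*} [Group G] {M : ℕ} {s : ℕ → G}

/-- `desc s a p * desc s (a + 1) p * ⋯ * desc s (a + q - 1) p` -/
def rows (s : ℕ → G) (p a : ℕ) : ℕ → G
  | 0 => 1
  | q + 1 => rows s p a q * desc s (a + q) p

/-- `asc s (a + p - 1) q * ⋯ * asc s (a + 1) q * asc s a q` -/
def cols (s : ℕ → G) (q a : ℕ) : ℕ → G
  | 0 => 1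
  | p + 1 => asc s (a + p) q * cols s q a p

theorem BraidSeq.comm_cols (hs : BraidSeq M s) {j q a p : ℕ} (h : a + p + q ≤ j) :
    Commute (s j) (cols s q a p) := by
  induction p with
  | zero => exact Commute.one_right _
  | succ p ih => exact (hs.comm_asc (by omega)).mul_right (ih (by omega))

theorem BraidSeq.cols_succ (hs : BraidSeq M s) (q a p : ℕ) :
    cols s (q + 1) a p = cols s q a p * desc s (a + q) p := by
  induction p with
  | zero => simp [cols, desc]
  | succ p ih =>
    have c := (hs.comm_cols (j := a + p + q) (q := q) (a := a) (p := p) (by omega)).eq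
    rw [cols, ih, asc, cols, desc, add_right_comm a q p, mul_assoc, ← mul_assoc (s _), c]
    simp only [mul_assoc]

theorem BraidSeq.rows_eq_cols (hs : BraidSeq M s) (p a q : ℕ) : rows s p a q = cols s q a p := by
  induction q with
  | zero =>
    have : ∀ p, cols s 0 a p = 1 := by
      intro p; induction p with
      | zero => rfl
      | succ p ih => simp [cols, asc, ih]
    rw [this]; rfl
  | succ q ih => rw [rows, ih, hs.cols_succ]

end Words

theorem cable_sg {m i : ℕ} (N : ℕ) (h : i < m - 1) (j : Fin m) :
    cable N j (sg m i) = cableWord (sg (m + N)) N i j := by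
  rw [sg, dif_pos h, cable_artin]

theorem cable_asc_lt {m N a k : ℕ} (h : a + k < m) (j : Fin m) (hj : j < a) :
    cable N j (asc (sg m) a k) = asc (sg (m + N)) (a + N) k := by
  induction k with
  | zero => simp [asc]
  | succ k ih =>
    have hp : perm (sg m (a + k)) j = j := by
      apply Fin.ext; rw [perm_sg (by omega), sw_of_lt (by omega)]
    rw [asc, cable_mul, hp, ih (by omega), cable_sg N (by omega), cableWord_lt (by omega), asc,
      add_right_comm]

theorem cable_asc_gt {m N a k : ℕ} (h : a + k < m) (j : Fin m) (hj : a + k < j) :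
    cable N j (asc (sg m) a k) = asc (sg (m + N)) a k := by
  induction k with
  | zero => simp [asc]
  | succ k ih =>
    have hp : perm (sg m (a + k)) j = j := by
      apply Fin.ext; rw [perm_sg (by omega), sw_of_gt (by omega)]
    rw [asc, cable_mul, hp, ih (by omega) (by omega), cable_sg N (by omega),
      cableWord_gt (by omega), asc]

theorem cable_desc_lt {m N a k : ℕ} (h : a + k < m) (j : Fin m) (hj : j < a) :
    cable N j (desc (sg m) a k) = desc (sg (m + N)) (a + N) k := by
  induction k with
  | zero => simp [desc]
  | succ k ih =>
    have hp : perm (desc (sg m) a k) j = j := by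
      apply Fin.ext; rw [perm_desc (by omega)]; split_ifs <;> omega
    rw [desc, cable_mul, hp, ih (by omega), cable_sg N (by omega), cableWord_lt (by omega), desc,
      add_right_comm]

theorem cable_desc_gt {m N a k : ℕ} (h : a + k < m) (j : Fin m) (hj : a + k < j) :
    cable N j (desc (sg m) a k) = desc (sg (m + N)) a k := by
  induction k with
  | zero => simp [desc]
  | succ k ih =>
    have hp : perm (desc (sg m) a k) j = j := by
      apply Fin.ext; rw [perm_desc (by omega)]; split_ifs <;> omega
    rw [desc, cable_mul, hp, ih (by omega) (by omega), cable_sg N (by omega),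
      cableWord_gt (by omega), desc]

theorem cable_asc_end {m N a k : ℕ} (j : Fin m) (hj : (j : ℕ) = a + k) :
    cable N j (asc (sg m) a k) = rows (sg (m + N)) (N + 1) a k := by
  induction k generalizing j with
  | zero => simp [asc, rows]
  | succ k ih =>
    have hp : (perm (sg m (a + k)) j : ℕ) = a + k := by
      rw [perm_sg (by omega), hj, ← add_assoc, sw_succ]
    rw [asc, cable_mul, ih _ hp, cable_sg N (by omega), hj, ← add_assoc, cableWord_succ, rows]

theorem cable_desc_start {m N a k : ℕ} (h : a + k < m) (j : Fin m) (hj : (j : ℕ) = a) :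
    cable N j (desc (sg m) a k) = cols (sg (m + N)) (N + 1) a k := by
  induction k with
  | zero => simp [desc, cols]
  | succ k ih =>
    have hp : (perm (desc (sg m) a k) j : ℕ) = a + k := by
      rw [perm_desc (by omega), if_pos hj]
    rw [desc, cable_mul, ih (by omega), cable_sg N (by omega), hp, cableWord_self, cols]

/-- The position of the strand `j` after the strand `l` is replaced by `N + 1` strands. -/
def shift {m : ℕ} (N : ℕ) (l j : Fin m) : Fin (m + N) :=
  if j < l then ⟨j, by omega⟩ else ⟨j + N, by omega⟩

theorem shift_val {m : ℕ} (N : ℕ) (l j : Fin m) :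
    (shift N l j : ℕ) = if (j : ℕ) < l then (j : ℕ) else j + N := by
  unfold shift; simp only [Fin.lt_def]; split_ifs <;> rfl

theorem collapse_shift {m N : ℕ} {l j : Fin m} (h : l ≠ j) : collapse N l (shift N l j) = j := by
  have h' : (l : ℕ) ≠ j := fun e => h (Fin.ext e)
  apply Fin.ext; rw [collapse_val, shift_val]; split_ifs <;> omega

theorem eq_shift {m N : ℕ} {l j : Fin m} (h : l ≠ j) {k : Fin (m + N)}
    (hk : collapse N l k = j) : k = shift N l j := by
  have h' : (l : ℕ) ≠ j := fun e => h (Fin.ext e)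
  have := congrArg Fin.val hk
  rw [collapse_val] at this
  apply Fin.ext; rw [shift_val]
  split_ifs at this ⊢ <;> omega

theorem perm_cable_shift {m N : ℕ} {l j : Fin m} (h : l ≠ j) (β : Braid m) :
    perm (cable N l β) (shift N l j) = shift N (perm β l) (perm β j) := by
  apply eq_shift (fun e => h ((perm β).injective e))
  rw [collapse_cable, collapse_shift h]

theorem perm_ins_shift {m n : ℕ} {l j : Fin m} (h : l ≠ j) (x : Braid n) :
    perm (ins m n l x) (shift (n - 1) l j) = shift (n - 1) l j := by
  apply eq_shift h
  rw [collapse_ins, collapse_shift h]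

theorem cable_cable_artin {m N : ℕ} {l j : Fin m} (h : l < j) (i : Fin (m - 1)) :
    cable N (shift N l j) (cable N l (artin i)) = cable N (shift N j l) (cable N j (artin i)) := by
  have hi := i.2
  have e1 : (shift N l j : ℕ) = j + N := by rw [shift_val, if_neg (by omega)]
  have e2 : (shift N j l : ℕ) = l := by rw [shift_val, if_pos (by omega)]
  rw [cable_artin, cable_artin]
  rcases lt_trichotomy (j : ℕ) i with h1 | h1 | h1
  · rw [cableWord_lt (by omega), cableWord_lt h1, cable_sg N (by omega), cable_sg N (by omega),
      cableWord_lt (by omega), cableWord_lt (by omega)]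
  · rw [cableWord_lt (by omega), h1, cableWord_self, cable_sg N (by omega),
      cable_asc_lt (by omega) _ (by omega), e1, h1, cableWord_self]
  rcases eq_or_ne (j : ℕ) (i + 1) with h2 | h2
  · rcases lt_trichotomy (l : ℕ) i with h3 | h3 | h3
    · rw [cableWord_lt (by omega), h2, cableWord_succ, cable_sg N (by omega),
        cable_desc_lt (by omega) _ (by omega), e1, h2, add_right_comm (i : ℕ) 1 N, cableWord_succ]
    · rw [h3, h2, cableWord_self, cableWord_succ, cable_asc_end _ (by omega),
        cable_desc_start (by omega) _ (by omega), (braidSeq_sg _).rows_eq_cols]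
    · omega
  rw [cableWord_gt (j := (j : ℕ)) (by omega), cable_sg N (by omega), e2]
  rcases lt_trichotomy (l : ℕ) i with h3 | h3 | h3
  · rw [cableWord_lt h3, cableWord_lt h3, cable_sg N (by omega), cableWord_gt (by omega)]
  · rw [h3, cableWord_self, cableWord_self, cable_asc_gt (by omega) _ (by omega)]
  rcases eq_or_ne (l : ℕ) (i + 1) with h4 | h4
  · rw [h4, cableWord_succ, cableWord_succ, cable_desc_gt (by omega) _ (by omega)]
  · rw [cableWord_gt (by omega), cableWord_gt (by omega), cable_sg N (by omega),
      cableWord_gt (by omega)]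

theorem cable_cable {m N : ℕ} {l j : Fin m} (h : l ≠ j) (β : Braid m) :
    cable N (shift N l j) (cable N l β) = cable N (shift N j l) (cable N j β) := by
  induction β using Braid.induct generalizing l j with
  | one => simp
  | gen i =>
    rcases lt_or_gt_of_ne h with h | h
    · exact cable_cable_artin h i
    · exact (cable_cable_artin h i).symm
  | mul x y hx hy =>
    have h' : perm y l ≠ perm y j := fun e => h ((perm y).injective e)
    rw [cable_mul, cable_mul, cable_mul, cable_mul, perm_cable_shift h, perm_cable_shift h.symm,
      hx h', hy h]
  | inv x hx =>
    have h' : perm x⁻¹ l ≠ perm x⁻¹ j := fun e => h ((perm x⁻¹).injective e)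
    have key : ∀ {l j : Fin m}, l ≠ j → cable N (shift N l j) (cable N l x⁻¹) =
        (cable N (shift N (perm x⁻¹ l) (perm x⁻¹ j)) (cable N (perm x⁻¹ l) x))⁻¹ := by
      intro l j h
      apply eq_inv_of_mul_eq_one_right
      rw [← perm_cable_shift h, ← cable_mul, ← cable_mul]; simp
    rw [key h, key h.symm, hx h']

theorem cable_ins {m n : ℕ} {l j : Fin m} (h : l ≠ j) (x : Braid n) :
    cable (n - 1) (shift (n - 1) l j) (ins m n l x) =
      ins (m + (n - 1)) n (shift (n - 1) j l) x := by
  induction x using Braid.induct with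
  | one => simp
  | gen i =>
    have hi := i.2
    have h' : (l : ℕ) ≠ j := fun e => h (Fin.ext e)
    rw [ins_artin, ins_artin, cable_sg _ (by omega), shift_val, shift_val]
    rcases lt_or_gt_of_ne h' with h1 | h1
    · rw [if_neg (by omega), if_pos h1, cableWord_gt (by omega)]
    · rw [if_pos h1, if_neg (by omega), cableWord_lt (by omega), add_right_comm (l : ℕ)]
  | mul x y hx hy => rw [map_mul, cable_mul, perm_ins_shift h, hx, hy, map_mul]
  | inv x hx =>
    rw [map_inv, map_inv, ← hx]
    apply eq_inv_of_mul_eq_one_right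
    have e : perm (ins m n l x)⁻¹ (shift (n - 1) l j) = shift (n - 1) l j := by
      rw [← map_inv, perm_ins_shift h]
    have c := cable_mul (n - 1) (shift (n - 1) l j) (ins m n l x) (ins m n l x)⁻¹
    rw [e, mul_inv_cancel, cable_one] at c
    exact c.symm

theorem ins_ins {m n : ℕ} {l j : Fin m} (h : l ≠ j) (x y : Braid n) :
    Commute (ins (m + (n - 1)) n (shift (n - 1) j l) x)
      (ins (m + (n - 1)) n (shift (n - 1) l j) y) := by
  have h' : (l : ℕ) ≠ j := fun e => h (Fin.ext e)
  induction x using Braid.induct with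
  | one => simp
  | gen i =>
    have hi := i.2
    induction y using Braid.induct with
    | one => simp
    | gen i' =>
      have hi' := i'.2
      rw [ins_artin, ins_artin, shift_val, shift_val]
      apply (braidSeq_sg _).comm
      split_ifs <;> omega
    | mul y z hy hz => rw [map_mul]; exact hy.mul_right hz
    | inv y hy => rw [map_inv]; exact hy.inv_right
  | mul x z hx hz => rw [map_mul]; exact hx.mul_left hz
  | inv x hx => rw [map_inv]; exact hx.inv_left

theorem collapse_collapse_lt {m N : ℕ} {l j : Fin m} (h : l < j) (k : Fin (m + N + N)) :
    collapse N l (collapse N (shift N l j) k) = collapse N j (collapse N (shift N j l) k) := by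
  have h' : (l : ℕ) < j := h
  have e1 : (shift N l j : ℕ) = j + N := by rw [shift_val, if_neg (by omega)]
  have e2 : (shift N j l : ℕ) = l := by rw [shift_val, if_pos (by omega)]
  have a1 := collapse_val N (shift N l j) k
  have a2 := collapse_val N (shift N j l) k
  have a3 := collapse_val N l (collapse N (shift N l j) k)
  have a4 := collapse_val N j (collapse N (shift N j l) k)
  apply Fin.ext
  rw [e1] at a1
  rw [e2] at a2
  rw [a3, a4, a1, a2]
  clear a1 a2 a3 a4 e1 e2 h
  generalize (k : ℕ) = k
  generalize (l : ℕ) = l at *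
  generalize (j : ℕ) = j at *
  rcases Nat.lt_or_ge k l with h1 | h1
  · simp [h1, show k < j + N by omega, show k < j by omega]
  rcases Nat.lt_or_ge (l + N) k with h2 | h2
  · simp only [show ¬ k < l by omega, show ¬ k ≤ l + N by omega, if_false]
    split_ifs <;> omega
  · simp only [show ¬ k < l by omega, show k ≤ l + N by omega, if_false, if_true]
    split_ifs <;> omega

theorem collapse_collapse {m N : ℕ} {l j : Fin m} (h : l ≠ j) (k : Fin (m + N + N)) :
    collapse N l (collapse N (shift N l j) k) = collapse N j (collapse N (shift N j l) k) := by
  rcases lt_or_gt_of_ne h with h | h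
  · exact collapse_collapse_lt h k
  · exact (collapse_collapse_lt h k).symm

/-! Labelled braids -/

/-- A braid on `m` strands with a label in the braid group on `n` strands on each strand.
The label of the strand that ends in position `j` is `label j`. -/
@[ext] structure LBraid (n m : ℕ) where
  braid : Braid m
  label : Fin m → Braid n

namespace LBraid

variable {n m : ℕ}

instance : One (LBraid n m) := ⟨⟨1, fun _ => 1⟩⟩

/-- Braids are composed from top to bottom, and labels are multiplied along the strands. -/
instance : Mul (LBraid n m) :=
  ⟨fun x y => ⟨x.braid * y.braid, fun j => x.label (perm y.braid j) * y.label j⟩⟩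

instance : Inv (LBraid n m) :=
  ⟨fun x => ⟨x.braid⁻¹, fun j => (x.label (perm x.braid⁻¹ j))⁻¹⟩⟩

@[simp] theorem one_braid : (1 : LBraid n m).braid = 1 := rfl
@[simp] theorem one_label (j : Fin m) : (1 : LBraid n m).label j = 1 := rfl
@[simp] theorem mul_braid (x y : LBraid n m) : (x * y).braid = x.braid * y.braid := rfl
@[simp] theorem mul_label (x y : LBraid n m) (j : Fin m) :
    (x * y).label j = x.label (perm y.braid j) * y.label j := rfl
@[simp] theorem inv_braid (x : LBraid n m) : x⁻¹.braid = x.braid⁻¹ := rfl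
@[simp] theorem inv_label (x : LBraid n m) (j : Fin m) :
    x⁻¹.label j = (x.label (perm x.braid⁻¹ j))⁻¹ := rfl

instance : Group (LBraid n m) where
  mul_assoc x y z := by ext1; · simp [mul_assoc]
                        · funext j; simp [mul_assoc]
  one_mul x := by ext1; · simp
                  · funext j; simp
  mul_one x := by ext1; · simp
                  · funext j; simp
  inv_mul_cancel x := by ext1; · simp
                         · funext j; simp

/-- The expansion at the strand that ends in position `j`: this strand, with label `h`, is replaced
by `n` parallel strands which are then braided by `h` and all carry the label `h`. -/
def expand (j : Fin m) (x : LBraid n m) : LBraid n (m + (n - 1)) :=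
  ⟨cable (n - 1) j x.braid * ins m n j (x.label j), fun k => x.label (collapse (n - 1) j k)⟩

@[simp] theorem expand_one (j : Fin m) : expand j (1 : LBraid n m) = 1 := by
  ext1
  · simp [expand]
  · funext k; simp [expand]

theorem expand_mul (j : Fin m) (x y : LBraid n m) :
    expand j (x * y) = expand (perm y.braid j) x * expand j y := by
  ext1
  · simp only [expand, mul_braid, mul_label, cable_mul, map_mul]
    rw [mul_assoc, mul_assoc, ← mul_assoc (cable _ j _), ← ins_cable]
    simp only [mul_assoc]
  · funext k
    simp only [expand, mul_label, map_mul, Equiv.Perm.mul_apply]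
    rw [collapse_cable, collapse_ins]

theorem perm_expand_shift {l j : Fin m} (h : l ≠ j) (x : LBraid n m) :
    perm (expand l x).braid (shift (n - 1) l j) =
      shift (n - 1) (perm x.braid l) (perm x.braid j) := by
  simp only [expand, map_mul, Equiv.Perm.mul_apply]
  rw [perm_ins_shift h, perm_cable_shift h]

theorem expand_comm {l j : Fin m} (h : l ≠ j) (x : LBraid n m) :
    expand (shift (n - 1) l j) (expand l x) = expand (shift (n - 1) j l) (expand j x) := by
  ext1
  · simp only [expand]
    rw [cable_mul, cable_mul, perm_ins_shift h, perm_ins_shift h.symm, collapse_shift h,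
      collapse_shift h.symm, cable_cable h, cable_ins h, cable_ins h.symm, mul_assoc, mul_assoc,
      (ins_ins h _ _).eq]
  · funext k
    exact congrArg x.label (collapse_collapse h k)

end LBraid

/-! Trees -/

/-- Finite full `n`-ary trees. -/
inductive NTree (n : ℕ) : Type
  | leaf : NTree n
  | node (f : Fin n → NTree n) : NTree n

namespace NTree

variable {n : ℕ}

/-- The leaves of a tree from left to right. A vertex is given by the word of the path that leads
to it from the root. -/
def leaves : NTree n → List (List (Fin n))
  | leaf => [[]]
  | node f => (List.finRange n).flatMap fun i => (leaves (f i)).map fun w => i :: w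

/-- The number of leaves. -/
def numLeaves (T : NTree n) : ℕ := T.leaves.length

/-- The depth of a tree is its number of carets. -/
def depth : NTree n → ℕ
  | leaf => 0
  | node f => 1 + ∑ i, depth (f i)

/-- The tree that consists of one caret. -/
def caret : NTree n := node fun _ => leaf

/-- `T.append w` is the tree obtained from `T` by appending a caret to the leaf `w`. (If the word
`w` is not a leaf of `T`, nothing is appended.) -/
def append : NTree n → List (Fin n) → NTree n
  | leaf, [] => caret
  | leaf, _ :: _ => leaf
  | node f, [] => node f
  | node f, i :: w => node (Function.update f i (append (f i) w))

/-- The leaf with index `k`, where the leaves are counted from left to right, starting at `0`. -/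
def leafAt (T : NTree n) (k : ℕ) : List (Fin n) := T.leaves.getD k []

/-- The word `w` is an inner vertex of the tree. -/
def Inner : NTree n → List (Fin n) → Prop
  | leaf, _ => False
  | node _, [] => True
  | node f, i :: w => Inner (f i) w

theorem mem_leaves_node {f : Fin n → NTree n} {w : List (Fin n)} :
    w ∈ (node f).leaves ↔ ∃ i, ∃ v ∈ (f i).leaves, i :: v = w := by
  simp [leaves]

theorem nodup_leaves (T : NTree n) : T.leaves.Nodup := by
  induction T with
  | leaf => simp [leaves]
  | node f ih =>
    rw [leaves, List.nodup_flatMap]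
    refine ⟨fun i _ => (ih i).map fun a b h => (List.cons.inj h).2, ?_⟩
    refine (List.nodup_finRange n).imp fun {a b} hab => ?_
    intro w h1 h2
    simp only [List.mem_map] at h1 h2
    obtain ⟨v, -, rfl⟩ := h1
    obtain ⟨v', -, h⟩ := h2
    exact hab (List.cons.inj h).1.symm

theorem not_inner {T : NTree n} {w : List (Fin n)} (h : w ∈ T.leaves) : ¬ T.Inner w := by
  induction T generalizing w with
  | leaf => simp [Inner]
  | node f ih =>
    obtain ⟨i, v, hv, rfl⟩ := mem_leaves_node.1 h
    exact ih i hv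

theorem leaves_append {T : NTree n} {w : List (Fin n)} (h : w ∈ T.leaves) :
    ∃ A B, T.leaves = A ++ w :: B ∧
      (T.append w).leaves = A ++ (List.finRange n).map (fun i => w ++ [i]) ++ B := by
  induction T generalizing w with
  | leaf =>
    obtain rfl : w = [] := by simpa [leaves] using h
    refine ⟨[], [], rfl, ?_⟩
    simp [append, caret, leaves]
    exact List.flatMap_pure_eq_map _ _
  | node f ih =>
    obtain ⟨i, v, hv, rfl⟩ := mem_leaves_node.1 h
    obtain ⟨A, B, h1, h2⟩ := ih i hv
    obtain ⟨P, Q, hPQ⟩ := List.append_of_mem (List.mem_finRange i)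
    have hnd := List.nodup_finRange n
    rw [hPQ] at hnd
    have hP : i ∉ P := fun hi => by
      have := List.disjoint_of_nodup_append hnd hi; simp at this
    have hQ : i ∉ Q := by
      have := (List.nodup_append.1 hnd).2.1; exact (List.nodup_cons.1 this).1
    have key : ∀ (g : Fin n → NTree n) (R : List (Fin n)), i ∉ R → ∀ S,
        (R.flatMap fun k => (leaves (Function.update g i S k)).map fun w => k :: w) =
        R.flatMap fun k => (leaves (g k)).map fun w => k :: w := by
      intro g R hR S
      refine List.flatMap_congr fun k hk => ?_
      rw [Function.update_of_ne (fun e => hR (by rw [← e]; exact hk))]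
    refine ⟨(P.flatMap fun k => (leaves (f k)).map fun w => k :: w) ++ A.map fun w => i :: w,
      (B.map fun w => i :: w) ++ (Q.flatMap fun k => (leaves (f k)).map fun w => k :: w), ?_, ?_⟩
    · rw [leaves, hPQ]; simp [h1]
    · rw [append, leaves]
      conv_lhs => rw [hPQ]
      simp only [List.flatMap_append, List.flatMap_cons, key f P hP, key f Q hQ,
        Function.update_self, h2]
      simp [Function.comp_def]

theorem inner_append {T : NTree n} {w : List (Fin n)} (h : w ∈ T.leaves) (v : List (Fin n)) :
    (T.append w).Inner v ↔ T.Inner v ∨ v = w := by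
  induction T generalizing w v with
  | leaf =>
    obtain rfl : w = [] := by simpa [leaves] using h
    cases v <;> simp [append, caret, Inner]
  | node f ih =>
    obtain ⟨i, u, hu, rfl⟩ := mem_leaves_node.1 h
    rw [append]
    cases v with
    | nil => simp [Inner]
    | cons k v =>
      simp only [Inner]
      rcases eq_or_ne k i with rfl | hk
      · simp [ih k hu]
      · simp [hk]

theorem ext_inner {T U : NTree n} (h : ∀ v, T.Inner v ↔ U.Inner v) : T = U := by
  induction T generalizing U with
  | leaf =>
    cases U with
    | leaf => rfl
    | node g => exact ((h []).2 trivial).elim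
  | node f ih =>
    cases U with
    | leaf => exact ((h []).1 trivial).elim
    | node g => exact congrArg node (funext fun i => ih i fun v => h (i :: v))

theorem append_comm {T : NTree n} {v w : List (Fin n)} (hv : v ∈ T.leaves) (hw : w ∈ T.leaves)
    (hv' : v ∈ (T.append w).leaves) (hw' : w ∈ (T.append v).leaves) :
    (T.append v).append w = (T.append w).append v := by
  apply ext_inner
  intro u
  rw [inner_append hw', inner_append hv', inner_append hv, inner_append hw]
  tauto

/-- `T.Le U` means that `U` is an expansion of `T`. -/
def Le (T U : NTree n) : Prop := ∀ v, T.Inner v → U.Inner v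

theorem exists_inner {T U : NTree n} (h : T.Le U) (hne : T ≠ U) : ∃ w ∈ T.leaves, U.Inner w := by
  induction T generalizing U with
  | leaf =>
    cases U with
    | leaf => exact absurd rfl hne
    | node g => exact ⟨[], by simp [leaves], trivial⟩
  | node f ih =>
    cases U with
    | leaf => exact (h [] trivial).elim
    | node g =>
      obtain ⟨i, hi⟩ : ∃ i, f i ≠ g i := by
        by_contra hc
        push Not at hc
        exact hne (congrArg node (funext hc))
      obtain ⟨w, hw, hw'⟩ := ih i (fun v hv => h (i :: v) hv) hi
      exact ⟨i :: w, mem_leaves_node.2 ⟨i, w, hw, rfl⟩, hw'⟩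

theorem depth_le {T U : NTree n} (h : T.Le U) : T.depth ≤ U.depth := by
  induction T generalizing U with
  | leaf => simp [depth]
  | node f ih =>
    cases U with
    | leaf => exact (h [] trivial).elim
    | node g =>
      simp only [depth]
      have := Finset.sum_le_sum fun i (_ : i ∈ Finset.univ) => ih i (U := g i) fun v hv => h (i :: v) hv
      omega

theorem depth_append {T : NTree n} {w : List (Fin n)} (h : w ∈ T.leaves) :
    (T.append w).depth = T.depth + 1 := by
  induction T generalizing w with
  | leaf =>
    obtain rfl : w = [] := by simpa [leaves] using h
    simp [append, caret, depth]
  | node f ih =>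
    obtain ⟨i, u, hu, rfl⟩ := mem_leaves_node.1 h
    have e : ∀ k, (Function.update f i ((f i).append u) k).depth =
        (f k).depth + if k = i then 1 else 0 := by
      intro k
      rcases eq_or_ne k i with rfl | hk
      · simp [ih k hu]
      · simp [hk]
    simp only [append, depth, e, Finset.sum_add_distrib]
    simp
    omega

theorem exists_le_le (T U : NTree n) : ∃ V, T.Le V ∧ U.Le V := by
  induction T generalizing U with
  | leaf => exact ⟨U, fun v hv => hv.elim, fun v hv => hv⟩
  | node f ih =>
    cases U with
    | leaf => exact ⟨node f, fun v hv => hv, fun v hv => hv.elim⟩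
    | node g =>
      choose V h1 h2 using fun i => ih i (g i)
      refine ⟨node V, ?_, ?_⟩
      · rintro (_ | ⟨i, v⟩) hv
        · trivial
        · exact h1 i v hv
      · rintro (_ | ⟨i, v⟩) hv
        · trivial
        · exact h2 i v hv

theorem leafAt_mem {T : NTree n} {k : ℕ} (h : k < T.numLeaves) : T.leafAt k ∈ T.leaves := by
  rw [leafAt, List.getD_eq_getElem _ _ h]; exact List.getElem_mem h

theorem exists_leafAt {T : NTree n} {w : List (Fin n)} (h : w ∈ T.leaves) :
    ∃ k < T.numLeaves, T.leafAt k = w := by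
  obtain ⟨k, hk, e⟩ := List.getElem_of_mem h
  exact ⟨k, hk, by rw [leafAt, List.getD_eq_getElem _ _ hk, e]⟩

theorem leafAt_inj {T : NTree n} {j k : ℕ} (hj : j < T.numLeaves) (hk : k < T.numLeaves)
    (h : T.leafAt j = T.leafAt k) : j = k := by
  rw [leafAt, leafAt, List.getD_eq_getElem _ _ hj, List.getD_eq_getElem _ _ hk] at h
  exact (T.nodup_leaves.getElem_inj_iff).1 h

theorem leaves_append_leafAt {T : NTree n} {k : ℕ} (h : k < T.numLeaves) :
    ∃ A B, A.length = k ∧ T.leaves = A ++ T.leafAt k :: B ∧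
      (T.append (T.leafAt k)).leaves =
        A ++ (List.finRange n).map (fun i => T.leafAt k ++ [i]) ++ B := by
  obtain ⟨A, B, h1, h2⟩ := leaves_append (leafAt_mem h)
  refine ⟨A, B, ?_, h1, h2⟩
  have hl : A.length < T.numLeaves := by rw [numLeaves, h1]; simp
  refine leafAt_inj hl h ?_
  conv_lhs => rw [leafAt, h1]
  simp

theorem numLeaves_append [NeZero n] {T : NTree n} {k : ℕ} (h : k < T.numLeaves) :
    (T.append (T.leafAt k)).numLeaves = T.numLeaves + (n - 1) := by
  obtain ⟨A, B, -, h1, h2⟩ := leaves_append_leafAt h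
  have := NeZero.pos n
  rw [numLeaves, numLeaves, h1, h2]
  simp
  omega

theorem leafAt_append [NeZero n] {T : NTree n} {j k : ℕ} (hk : k < T.numLeaves) (h : j ≠ k) :
    (T.append (T.leafAt k)).leafAt (if j < k then j else j + (n - 1)) = T.leafAt j := by
  obtain ⟨A, B, h0, h1, h2⟩ := leaves_append_leafAt hk
  have := NeZero.pos n
  simp only [leafAt] at h1 h2 ⊢
  rw [h2]
  conv_rhs => rw [h1]
  split_ifs with hjk
  · rw [List.append_assoc, List.getD_append _ _ _ _ (by omega),
      List.getD_append _ _ _ _ (by omega)]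
  · rw [List.getD_append_right _ _ _ _ (by simp; omega),
      List.getD_append_right _ _ _ _ (by omega)]
    obtain ⟨p, rfl⟩ := Nat.exists_eq_add_of_le (show k + 1 ≤ j by omega)
    rw [h0, show k + 1 + p - k = p + 1 by omega, List.getD_cons_succ]
    congr 1
    simp
    omega

end NTree

/-! The group `BV n` -/

/-- A tree pair `(T, β, λ, T')`: two trees with `m` leaves, and a braid with labels that connects the
leaves of `T` with those of `T'`. -/
structure TreePair (n : ℕ) where
  m : ℕ
  dom : NTree n
  ran : NTree n
  dom_leaves : dom.numLeaves = m
  ran_leaves : ran.numLeaves = m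
  x : LBraid n m

namespace TreePair

variable {n : ℕ}

/-- `IsComp p q r`: the range tree of `p` is the domain tree of `q`, and `r` is the composition. -/
inductive IsComp : TreePair n → TreePair n → TreePair n → Prop
  | mk (m : ℕ) (T T' T'' : NTree n) (h : T.numLeaves = m) (h' : T'.numLeaves = m)
      (h'' : T''.numLeaves = m) (x y : LBraid n m) :
      IsComp ⟨m, T, T', h, h', x⟩ ⟨m, T', T'', h', h'', y⟩ ⟨m, T, T'', h, h'', x * y⟩

/-- The tree pair `(T', x⁻¹, T)`. -/
def flip (p : TreePair n) : TreePair n := ⟨p.m, p.ran, p.dom, p.ran_leaves, p.dom_leaves, p.x⁻¹⟩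

/-- The tree pair `(T, Id, T)`. -/
def ident (T : NTree n) : TreePair n := ⟨T.numLeaves, T, T, rfl, rfl, 1⟩

theorem ext_of {m : ℕ} {T T' U U' : NTree n} {h h' k k'} {x y : LBraid n m} (e1 : T = U)
    (e2 : T' = U') (e3 : x = y) : (⟨m, T, T', h, h', x⟩ : TreePair n) = ⟨m, U, U', k, k', y⟩ := by
  subst e1 e2 e3; rfl

theorem ran_leaf_mem (p : TreePair n) (j : Fin p.m) : p.ran.leafAt j ∈ p.ran.leaves :=
  NTree.leafAt_mem (by rw [p.ran_leaves]; exact j.2)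

theorem IsComp.ran_eq {p q r : TreePair n} (h : IsComp p q r) : p.ran = q.dom := by cases h; rfl

theorem IsComp.unique {p q r r' : TreePair n} (h : IsComp p q r) (h' : IsComp p q r') : r = r' := by
  cases h; cases h'; rfl

theorem exists_isComp {p q : TreePair n} (h : p.ran = q.dom) : ∃ r, IsComp p q r := by
  obtain ⟨m, T, T', h1, h2, x⟩ := p
  obtain ⟨m', U, U', h3, h4, y⟩ := q
  obtain rfl : T' = U := h
  obtain rfl : m = m' := h2.symm.trans h3
  exact ⟨_, IsComp.mk _ _ _ _ _ _ _ _ _⟩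

variable [NeZero n]

/-- The expansion at the `j`-th leaf of the range tree: a caret is appended to this leaf and to the
leaf of the domain tree that is connected with it. -/
def expand (p : TreePair n) (j : Fin p.m) : TreePair n where
  m := p.m + (n - 1)
  dom := p.dom.append (p.dom.leafAt (perm p.x.braid j))
  ran := p.ran.append (p.ran.leafAt j)
  dom_leaves := by
    rw [NTree.numLeaves_append (by rw [p.dom_leaves]; omega), p.dom_leaves]
  ran_leaves := by
    rw [NTree.numLeaves_append (by rw [p.ran_leaves]; omega), p.ran_leaves]
  x := p.x.expand j

/-- `q` is an expansion of `p` by one caret. -/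
def Step (p q : TreePair n) : Prop := ∃ j, q = p.expand j

theorem append_comm_shift {T : NTree n} {m : ℕ} (h : T.numLeaves = m) {l j : Fin m} (hlj : l ≠ j) :
    (T.append (T.leafAt l)).append ((T.append (T.leafAt l)).leafAt (shift (n - 1) l j)) =
      (T.append (T.leafAt j)).append ((T.append (T.leafAt j)).leafAt (shift (n - 1) j l)) := by
  have h' : (l : ℕ) ≠ j := fun e => hlj (Fin.ext e)
  have e1 := NTree.leafAt_append (T := T) (j := j) (k := l) (by omega) h'.symm
  have e2 := NTree.leafAt_append (T := T) (j := l) (k := j) (by omega) h'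
  have n1 := NTree.numLeaves_append (T := T) (k := l) (by omega)
  have n2 := NTree.numLeaves_append (T := T) (k := j) (by omega)
  have m1 := NTree.leafAt_mem (T := T.append (T.leafAt l)) (k := shift (n - 1) l j)
    (by rw [n1]; omega)
  have m2 := NTree.leafAt_mem (T := T.append (T.leafAt j)) (k := shift (n - 1) j l)
    (by rw [n2]; omega)
  rw [shift_val] at m1 m2 ⊢
  rw [shift_val]
  rw [e1] at m1 ⊢
  rw [e2] at m2 ⊢
  exact NTree.append_comm (NTree.leafAt_mem (by omega)) (NTree.leafAt_mem (by omega)) m2 m1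

theorem expand_comm (p : TreePair n) {l j : Fin p.m} (h : l ≠ j) :
    (p.expand l).expand (shift (n - 1) l j) = (p.expand j).expand (shift (n - 1) j l) := by
  have h' : perm p.x.braid l ≠ perm p.x.braid j := fun e => h ((perm _).injective e)
  refine ext_of ?_ ?_ (LBraid.expand_comm h p.x)
  · have e1 := congrArg Fin.val (LBraid.perm_expand_shift h p.x)
    have e2 := congrArg Fin.val (LBraid.perm_expand_shift h.symm p.x)
    have e := append_comm_shift p.dom_leaves h'
    rw [← e1, ← e2] at e
    exact e
  · exact append_comm_shift p.ran_leaves h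

theorem step_diamond {p q r : TreePair n} (hq : Step p q) (hr : Step p r) :
    q = r ∨ ∃ s, Step q s ∧ Step r s := by
  obtain ⟨l, rfl⟩ := hq
  obtain ⟨j, rfl⟩ := hr
  rcases eq_or_ne l j with rfl | h
  · exact Or.inl rfl
  · exact Or.inr ⟨_, ⟨_, rfl⟩, ⟨_, expand_comm p h⟩⟩

/-- Iterated expansions. -/
abbrev Steps : TreePair n → TreePair n → Prop := Relation.ReflTransGen Step

theorem steps_join {p q r : TreePair n} (hq : Steps p q) (hr : Steps p r) :
    ∃ s, Steps q s ∧ Steps r s := by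
  refine Relation.church_rosser (fun a b c hb hc => ?_) hq hr
  rcases step_diamond hb hc with rfl | ⟨s, h1, h2⟩
  · exact ⟨b, .refl, .refl⟩
  · exact ⟨s, .single h1, .single h2⟩

theorem eqvGen_join {p q : TreePair n} (h : Relation.EqvGen Step p q) :
    ∃ s, Steps p s ∧ Steps q s := by
  induction h with
  | rel p q h => exact ⟨q, .single h, .refl⟩
  | refl p => exact ⟨p, .refl, .refl⟩
  | symm p q _ ih => obtain ⟨s, h1, h2⟩ := ih; exact ⟨s, h2, h1⟩
  | trans p q r _ _ ih1 ih2 =>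
    obtain ⟨s, h1, h2⟩ := ih1
    obtain ⟨t, h3, h4⟩ := ih2
    obtain ⟨u, h5, h6⟩ := steps_join h2 h3
    exact ⟨u, h1.trans h5, h4.trans h6⟩

theorem Step.ran_le {p q : TreePair n} (h : Step p q) : p.ran.Le q.ran := by
  obtain ⟨j, rfl⟩ := h
  exact fun v hv => (NTree.inner_append (p.ran_leaf_mem j) v).2 (Or.inl hv)

theorem Step.depth {p q : TreePair n} (h : Step p q) : q.ran.depth = p.ran.depth + 1 := by
  obtain ⟨j, rfl⟩ := h
  exact NTree.depth_append (p.ran_leaf_mem j)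

theorem Steps.ran_le {p q : TreePair n} (h : Steps p q) : p.ran.Le q.ran := by
  induction h with
  | refl => exact fun v hv => hv
  | tail _ h ih => exact fun v hv => h.ran_le v (ih v hv)

theorem steps_to (p : TreePair n) {U : NTree n} (h : p.ran.Le U) : ∃ q, Steps p q ∧ q.ran = U := by
  generalize hd : U.depth - p.ran.depth = d
  induction d using Nat.strong_induction_on generalizing p with
  | _ d ih =>
    by_cases he : p.ran = U
    · exact ⟨p, .refl, he⟩
    obtain ⟨w, hw, hU⟩ := NTree.exists_inner h he
    obtain ⟨k, hk, rfl⟩ := NTree.exists_leafAt hw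
    have hk' : k < p.m := by rw [← p.ran_leaves]; exact hk
    have hs : Step p (p.expand ⟨k, hk'⟩) := ⟨_, rfl⟩
    have hle : (p.expand ⟨k, hk'⟩).ran.Le U := by
      intro v hv
      rcases (NTree.inner_append (p.ran_leaf_mem ⟨k, hk'⟩) v).1 hv with hv | rfl
      · exact h v hv
      · exact hU
    have h1 := hs.depth
    have h2 := NTree.depth_le hle
    obtain ⟨q, hq, e⟩ := ih _ (by omega) _ hle rfl
    exact ⟨q, .head hs hq, e⟩

theorem steps_unique {p q r : TreePair n} (hq : Steps p q) (hr : Steps p r) (h : q.ran = r.ran) :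
    q = r := by
  generalize hd : q.ran.depth - p.ran.depth = d
  induction d using Nat.strong_induction_on generalizing p q r with
  | _ d ih =>
    rcases hq.cases_head with rfl | ⟨a, ha, haq⟩
    · rcases hr.cases_head with rfl | ⟨b, hb, hbr⟩
      · rfl
      · have h1 := hb.depth
        have h2 := NTree.depth_le (Steps.ran_le hbr)
        rw [h] at h1; omega
    rcases hr.cases_head with rfl | ⟨b, hb, hbr⟩
    · have h1 := ha.depth
      have h2 := NTree.depth_le (Steps.ran_le haq)
      rw [← h] at h1; omega
    have ha1 := ha.depth
    have hb1 := hb.depth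
    have ha2 := NTree.depth_le (Steps.ran_le haq)
    have hb2 := NTree.depth_le (Steps.ran_le hbr)
    have hh := congrArg NTree.depth h
    obtain ⟨l, rfl⟩ := ha
    obtain ⟨j, rfl⟩ := hb
    rcases eq_or_ne l j with rfl | hlj
    · exact ih _ (by omega) haq hbr h rfl
    have hc := expand_comm p hlj
    have s1 : Step (p.expand l) ((p.expand l).expand (shift (n - 1) l j)) := ⟨_, rfl⟩
    have s2 : Step (p.expand j) ((p.expand l).expand (shift (n - 1) l j)) := ⟨_, hc⟩
    have hle : ((p.expand l).expand (shift (n - 1) l j)).ran.Le q.ran := by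
      intro v hv
      have hv' := (NTree.inner_append ((p.expand l).ran_leaf_mem _) v).1 hv
      rcases hv' with hv' | rfl
      · exact Steps.ran_le haq v hv'
      · have e : (p.expand l).ran.leafAt (shift (n - 1) l j) = p.ran.leafAt j := by
          have h' : (l : ℕ) ≠ j := fun e => hlj (Fin.ext e)
          have := NTree.leafAt_append (T := p.ran) (j := j) (k := l)
            (by rw [p.ran_leaves]; exact l.2) h'.symm
          rw [shift_val]; exact this
        rw [e, h]
        exact Steps.ran_le hbr _ ((NTree.inner_append (p.ran_leaf_mem j) _).2 (Or.inr rfl))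
    obtain ⟨w, hw, he⟩ := steps_to _ hle
    have w1 : q = w := ih _ (by omega) haq (.head s1 hw) he.symm rfl
    have w2 : r = w := ih _ (by omega) hbr (.head s2 hw) (by rw [← h, he]) rfl
    rw [w1, w2]

theorem IsComp.expand {p q r : TreePair n} (h : IsComp p q r) (j : Fin q.m) :
    ∃ p' r', Step p p' ∧ Step r r' ∧ IsComp p' (q.expand j) r' := by
  obtain ⟨m, T, T', T'', h, h', h'', x, y⟩ := h
  refine ⟨_, _, ⟨perm y.braid j, rfl⟩, ⟨j, rfl⟩, ?_⟩
  simp only [TreePair.expand, LBraid.expand_mul, LBraid.mul_braid, map_mul, Equiv.Perm.mul_apply]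
  exact IsComp.mk _ _ _ _ _ _ _ _ _

theorem IsComp.step_right {p q r q' : TreePair n} (h : IsComp p q r) (hq : Step q q') :
    ∃ p' r', Step p p' ∧ Step r r' ∧ IsComp p' q' r' := by
  obtain ⟨j, rfl⟩ := hq
  exact h.expand j

theorem IsComp.step_left {p q r p' : TreePair n} (h : IsComp p q r) (hp : Step p p') :
    ∃ q' r', Step q q' ∧ Step r r' ∧ IsComp p' q' r' := by
  obtain ⟨j, rfl⟩ := hp
  obtain ⟨m, T, T', T'', h, h', h'', x, y⟩ := h
  refine ⟨_, _, ⟨perm y.braid⁻¹ j, rfl⟩, ⟨perm y.braid⁻¹ j, rfl⟩, ?_⟩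
  simp only [TreePair.expand, LBraid.expand_mul, LBraid.mul_braid, map_mul, Equiv.Perm.mul_apply,
    perm_inv]
  exact IsComp.mk _ _ _ _ _ _ _ _ _

theorem IsComp.steps_right {p q r q' : TreePair n} (h : IsComp p q r) (hq : Steps q q') :
    ∃ p' r', Steps p p' ∧ Steps r r' ∧ IsComp p' q' r' := by
  induction hq with
  | refl => exact ⟨p, r, .refl, .refl, h⟩
  | tail _ hs ih =>
    obtain ⟨p1, r1, h1, h2, h3⟩ := ih
    obtain ⟨p2, r2, h4, h5, h6⟩ := h3.step_right hs
    exact ⟨p2, r2, h1.tail h4, h2.tail h5, h6⟩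

theorem IsComp.steps_left {p q r p' : TreePair n} (h : IsComp p q r) (hp : Steps p p') :
    ∃ q' r', Steps q q' ∧ Steps r r' ∧ IsComp p' q' r' := by
  induction hp with
  | refl => exact ⟨q, r, .refl, .refl, h⟩
  | tail _ hs ih =>
    obtain ⟨p1, r1, h1, h2, h3⟩ := ih
    obtain ⟨p2, r2, h4, h5, h6⟩ := h3.step_left hs
    exact ⟨p2, r2, h1.tail h4, h2.tail h5, h6⟩

theorem flip_step {p q : TreePair n} (h : Step p q) : Step p.flip q.flip := by
  obtain ⟨j, rfl⟩ := h
  refine ⟨perm p.x.braid j, ?_⟩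
  refine ext_of ?_ rfl ?_
  · have e : perm p.x⁻¹.braid (perm p.x.braid j) = j := perm_inv' _ _
    have e' := congrArg (fun k : Fin p.m => p.ran.append (p.ran.leafAt k)) e
    exact e'.symm
  · have e := LBraid.expand_mul j p.x⁻¹ p.x
    rw [inv_mul_cancel, LBraid.expand_one] at e
    exact inv_eq_of_mul_eq_one_left e.symm

theorem ident_step (T : NTree n) {q : TreePair n} (h : Step (ident T) q) : q = ident q.ran := by
  obtain ⟨j, rfl⟩ := h
  have e : ((ident T).expand j).m = ((ident T).expand j).ran.numLeaves :=
    ((ident T).expand j).ran_leaves.symm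
  have hp : perm (ident T).x.braid j = j := by
    change perm 1 _ = _
    rw [map_one]; rfl
  have hx : (ident T).x.expand j = 1 := LBraid.expand_one j
  have key : ∀ (m : ℕ) (U V : NTree n) (hU : U.numLeaves = m) (hV : V.numLeaves = m)
      (x : LBraid n m), U = V → x = 1 → (⟨m, U, V, hU, hV, x⟩ : TreePair n) = ident V := by
    rintro m U V hU rfl x rfl rfl
    rfl
  refine key _ _ _ _ _ _ ?_ hx
  exact congrArg (fun k : Fin (ident T).m => T.append (T.leafAt k)) hp

theorem ident_steps (T : NTree n) {q : TreePair n} (h : Steps (ident T) q) : q = ident q.ran := by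
  induction h with
  | refl => rfl
  | tail _ hs ih => rw [ih] at hs; exact ident_step _ hs

theorem steps_from (p : TreePair n) {U : NTree n} (h : p.dom.Le U) : ∃ q, Steps p q ∧ q.dom = U := by
  have hff : p.flip.flip = p := ext_of rfl rfl (inv_inv p.x)
  obtain ⟨q, hq, e⟩ := steps_to p.flip (U := U) h
  refine ⟨q.flip, ?_, e⟩
  have : Steps p.flip.flip q.flip := by
    clear e
    induction hq with
    | refl => exact .refl
    | tail _ hs ih => exact ih.tail (flip_step hs)
  rwa [hff] at this

end TreePair

/-- The braided Thompson group with recursive braids of all types in the braid group on `n` strands: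
tree pairs modulo the equivalence relation that is generated by expansions. -/
def BV (n : ℕ) [NeZero n] : Type := Quot (TreePair.Step (n := n))

namespace BV

open TreePair

variable {n : ℕ} [NeZero n]

/-- The element that is represented by a tree pair. -/
def mk (p : TreePair n) : BV n := Quot.mk _ p

theorem mk_eq_of_steps {p q : TreePair n} (h : Steps p q) : mk p = mk q := by
  induction h with
  | refl => rfl
  | tail _ hs ih => exact ih.trans (Quot.sound hs)

theorem mk_eq_iff {p q : TreePair n} : mk p = mk q ↔ ∃ s, Steps p s ∧ Steps q s := by
  constructor
  · exact fun h => eqvGen_join (Quot.eqvGen_exact h)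
  · rintro ⟨s, h1, h2⟩
    exact (mk_eq_of_steps h1).trans (mk_eq_of_steps h2).symm

theorem isComp_unique {p q r p' q' r' : TreePair n} (h : IsComp p q r) (h' : IsComp p' q' r')
    (hp : mk p = mk p') (hq : mk q = mk q') : mk r = mk r' := by
  obtain ⟨P, hP, hP'⟩ := mk_eq_iff.1 hp
  obtain ⟨s, t, hs, ht, hc⟩ := h.steps_left hP
  obtain ⟨s', t', hs', ht', hc'⟩ := h'.steps_left hP'
  have e : mk s = mk s' := by rw [← mk_eq_of_steps hs, ← mk_eq_of_steps hs', hq]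
  obtain ⟨u, hu, hu'⟩ := mk_eq_iff.1 e
  obtain ⟨P1, v, h1, h2, h3⟩ := hc.steps_right hu
  obtain ⟨P2, v', h1', h2', h3'⟩ := hc'.steps_right hu'
  have : P1 = P2 := steps_unique h1 h1' (by rw [h3.ran_eq, h3'.ran_eq])
  subst this
  have : v = v' := h3.unique h3'
  subst this
  rw [mk_eq_of_steps ht, mk_eq_of_steps ht', mk_eq_of_steps h2, mk_eq_of_steps h2']

theorem exists_comp (a b : BV n) : ∃ p q r, mk p = a ∧ mk q = b ∧ IsComp p q r := by
  obtain ⟨p, rfl⟩ := Quot.exists_rep a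
  obtain ⟨q, rfl⟩ := Quot.exists_rep b
  obtain ⟨V, h1, h2⟩ := NTree.exists_le_le p.ran q.dom
  obtain ⟨p', hp, ep⟩ := steps_to p h1
  obtain ⟨q', hq, eq⟩ := steps_from q h2
  obtain ⟨r, hr⟩ := exists_isComp (ep.trans eq.symm)
  exact ⟨p', q', r, (mk_eq_of_steps hp).symm, (mk_eq_of_steps hq).symm, hr⟩

theorem exists_mul (a b : BV n) : ∃ c, ∃ p q r, mk p = a ∧ mk q = b ∧ mk r = c ∧ IsComp p q r := by
  obtain ⟨p, q, r, h1, h2, h3⟩ := exists_comp a b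
  exact ⟨mk r, p, q, r, h1, h2, rfl, h3⟩

/-- The product is represented by the composition of representatives such that the range tree of the
first is the domain tree of the second. -/
noncomputable instance : Mul (BV n) := ⟨fun a b => (exists_mul a b).choose⟩

theorem mk_mul_mk {p q r : TreePair n} (h : IsComp p q r) : mk p * mk q = mk r := by
  obtain ⟨p', q', r', h1, h2, h3, h4⟩ := (exists_mul (mk p) (mk q)).choose_spec
  exact h3.symm.trans (isComp_unique h4 h h1 h2)

instance : One (BV n) := ⟨mk (ident NTree.leaf)⟩

instance : Inv (BV n) :=
  ⟨Quot.lift (fun p => mk p.flip) fun _ _ h => Quot.sound (flip_step h)⟩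

theorem mk_inv (p : TreePair n) : (mk p)⁻¹ = mk p.flip := rfl

theorem mk_ident (T : NTree n) : mk (ident T) = 1 := by
  obtain ⟨q, hq, e⟩ := steps_to (ident (NTree.leaf : NTree n)) (U := T) (fun _ h => h.elim)
  rw [← e, ← ident_steps _ hq]
  exact (mk_eq_of_steps hq).symm

theorem one_mul' (a : BV n) : 1 * a = a := by
  obtain ⟨⟨m, T, T', rfl, h', x⟩, rfl⟩ := Quot.exists_rep a
  rw [← mk_ident T]
  refine (mk_mul_mk (IsComp.mk _ _ _ _ rfl rfl h' _ _)).trans ?_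
  rw [one_mul]; rfl

theorem mul_one' (a : BV n) : a * 1 = a := by
  obtain ⟨⟨m, T, T', h, rfl, x⟩, rfl⟩ := Quot.exists_rep a
  rw [← mk_ident T']
  refine (mk_mul_mk (IsComp.mk _ _ _ _ h rfl rfl _ _)).trans ?_
  rw [mul_one]; rfl

theorem inv_mul_cancel' (a : BV n) : a⁻¹ * a = 1 := by
  obtain ⟨⟨m, T, T', h, rfl, x⟩, rfl⟩ := Quot.exists_rep a
  rw [← mk_ident T']
  refine (mk_mul_mk (IsComp.mk _ _ _ _ rfl h rfl _ _)).trans ?_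
  rw [inv_mul_cancel]; rfl

theorem mul_assoc' (a b c : BV n) : a * b * c = a * (b * c) := by
  obtain ⟨p, q, r, rfl, rfl, h1⟩ := exists_comp a b
  obtain ⟨s, rfl⟩ := Quot.exists_rep c
  change mk p * mk q * mk s = mk p * (mk q * mk s)
  obtain ⟨V, hq, hs⟩ := NTree.exists_le_le q.ran s.dom
  obtain ⟨q', hq', eq⟩ := steps_to q hq
  obtain ⟨s', hs', es⟩ := steps_from s hs
  obtain ⟨p', r', hp', hr', h2⟩ := h1.steps_right hq'
  obtain ⟨t, h3⟩ := exists_isComp (eq.trans es.symm)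
  rw [mk_eq_of_steps hp', mk_eq_of_steps hq', mk_eq_of_steps hs', mk_mul_mk h2, mk_mul_mk h3]
  cases h2
  cases h3
  rw [mk_mul_mk (IsComp.mk _ _ _ _ _ _ _ _ _), mk_mul_mk (IsComp.mk _ _ _ _ _ _ _ _ _),
    mul_assoc]

noncomputable instance : Group (BV n) where
  mul_assoc := mul_assoc'
  one_mul := one_mul'
  mul_one := mul_one'
  inv_mul_cancel := inv_mul_cancel'

end BV

/-! The generators -/

/-- The tree `T(n)`: the caret with carets appended to `0`, `1`, `00` and `01` if `n = 2`, and to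
`0`, `1` and `2` if `n > 2`. -/
def baseTree (n : ℕ) [NeZero n] : NTree n :=
  if n = 2 then (((NTree.caret.append [0]).append [1]).append [0, 0]).append [0, 1]
  else ((NTree.caret.append [0]).append [1]).append [2]

theorem NTree.numLeaves_caret (n : ℕ) : (NTree.caret : NTree n).numLeaves = n := by
  simp [NTree.numLeaves, NTree.caret, NTree.leaves]

namespace TreePair

variable {n : ℕ} [NeZero n]

/-- `e_T = (T, Id, (Id, …, Id), T(n))` -/
def typeE (T : NTree n) (h : T.numLeaves = (baseTree n).numLeaves) : TreePair n where
  m := (baseTree n).numLeaves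
  dom := T
  ran := baseTree n
  dom_leaves := h
  ran_leaves := rfl
  x := ⟨1, fun _ => 1⟩

/-- `h_i = (T(n), σ_i, (Id, …, Id), T(n))` -/
def typeH (i : Fin ((baseTree n).numLeaves - 1)) : TreePair n where
  m := (baseTree n).numLeaves
  dom := baseTree n
  ran := baseTree n
  dom_leaves := rfl
  ran_leaves := rfl
  x := ⟨artin i, fun _ => 1⟩

/-- `g_j = (R, Id, (σ_j, Id, …, Id), R)`, where `R` is the tree of depth `1`. -/
def typeG (j : Fin (n - 1)) : TreePair n where
  m := n
  dom := NTree.caret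
  ran := NTree.caret
  dom_leaves := NTree.numLeaves_caret n
  ran_leaves := NTree.numLeaves_caret n
  x := ⟨1, Function.update (fun _ => 1) 0 (artin j)⟩

end TreePair

/-- The tree pairs of the three types. -/
def generatorPairs (n : ℕ) [NeZero n] : Set (TreePair n) :=
  {p | ∃ T h, p = TreePair.typeE T h} ∪ Set.range TreePair.typeH ∪ Set.range TreePair.typeG

end BraidedThompson

/-!
The subgroup `H` generated by the given tree pairs is shown to contain every tree pair with at least
as many leaves as the tree `T(n)`; every element has such a representative. Write `(T, x, T')` for the
element represented by two trees and a labelled braid `x`, so that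
`(T, x, T') (T', y, T'') = (T, x y, T'')`.

* Trivial braid and labels (`elt_one_mem`). The tree pairs `e_T` give all `(T, 1, T')` with `m(n)`
  leaves. For the induction on the number of leaves, write each tree as a smaller tree with a caret
  appended to its leaf number `k`. Two trees with the same `k` are related by an expansion of a
  smaller pair. If `k + n ≤ l`, then some tree ends in carets at the positions `k` and `l` at once,
  so `k` and `l` are related too; as there are at least `2 n` leaves in the smaller tree, this
  connects all positions. Hence membership of `(T, x, T')` in `H` depends on `x` only
  (`elt_mem_of_elt_mem`).
* Braids (`elt_ofBraid_mem`). It suffices to treat a single crossing. When there are enough strands,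
  it is obtained from a crossing of fewer strands by expanding at a strand that is not crossed, the
  first or the last; with `m(n)` strands it is one of the `h_i`.
* Labels (`elt_ofLabels_mem`). It suffices to treat a single nontrivial label, which is an Artin
  generator. Conjugation by a braid moves it to the first strand, and the label of the first strand
  of `g_j` persists when `g_j` is expanded repeatedly at the last leaf.

The remaining assertions hold because a full `n`-ary tree of depth `d` has `1 + (n - 1) d` leaves,
and because there are only finitely many trees of bounded depth.
-/

namespace BraidedThompson

/-! ### Full trees -/

namespace NTree

variable {n : ℕ}

theorem exists_eq_append {T : NTree n} (h : T ≠ leaf) : ∃ S : NTree n, ∃ w ∈ S.leaves, T = S.append w := by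
  induction T with
  | leaf => exact absurd rfl h
  | node f ih =>
    by_cases hf : ∀ i, f i = leaf
    · obtain rfl : f = fun _ => leaf := funext hf
      exact ⟨leaf, [], by simp [leaves], rfl⟩
    · push Not at hf
      obtain ⟨i, hi⟩ := hf
      obtain ⟨S, w, hw, e⟩ := ih i hi
      refine ⟨node (Function.update f i S), i :: w,
        mem_leaves_node.2 ⟨i, w, by simpa using hw, rfl⟩, ?_⟩
      simp [append, ← e]

theorem mem_leaves_append {T : NTree n} {v w : List (Fin n)} (hw : w ∈ T.leaves)
    (hv : v ∈ T.leaves) (hne : v ≠ w) : v ∈ (T.append w).leaves := by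
  obtain ⟨A, B, h1, h2⟩ := leaves_append hw
  rw [h1] at hv
  rw [h2]
  simp only [List.mem_append, List.mem_cons] at hv ⊢
  tauto

theorem concat_mem_leaves_append {T : NTree n} {w : List (Fin n)} (hw : w ∈ T.leaves) (i : Fin n) :
    w ++ [i] ∈ (T.append w).leaves := by
  obtain ⟨A, B, -, h2⟩ := leaves_append hw
  rw [h2]
  simp

theorem singleton_mem_leaves_caret (i : Fin n) : [i] ∈ (caret : NTree n).leaves :=
  mem_leaves_node.2 ⟨i, [], by simp [leaves], rfl⟩

theorem depth_caret : (caret : NTree n).depth = 1 := by simp [caret, depth]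

theorem finite_depth_le (n d : ℕ) : {T : NTree n | T.depth ≤ d}.Finite := by
  induction d with
  | zero =>
    refine (Set.finite_singleton leaf).subset fun T hT => ?_
    cases T with
    | leaf => rfl
    | node f => simp [depth] at hT
  | succ d ih =>
    refine ((Set.Finite.pi' fun _ : Fin n => ih).image node |>.insert leaf).subset fun T hT => ?_
    cases T with
    | leaf => exact Or.inl rfl
    | node f =>
      refine Or.inr ⟨f, fun i => ?_, rfl⟩
      have h1 := Finset.single_le_sum (f := fun i => (f i).depth) (fun _ _ => Nat.zero_le _)
        (Finset.mem_univ i)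
      simp only [Set.mem_ofPred_eq, depth] at hT h1 ⊢
      omega

theorem exists_eq_append_of_one_lt {T : NTree n} (h : 1 < T.numLeaves) :
    ∃ (S : NTree n) (k : Fin S.numLeaves), T = S.append (S.leafAt k) := by
  obtain ⟨S, w, hw, rfl⟩ := exists_eq_append (T := T) (by rintro rfl; simp [numLeaves, leaves] at h)
  obtain ⟨k, hk, rfl⟩ := exists_leafAt hw
  exact ⟨S, ⟨k, hk⟩, rfl⟩

variable [NeZero n]

theorem numLeaves_eq (T : NTree n) : T.numLeaves = 1 + (n - 1) * T.depth := by
  generalize hd : T.depth = d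
  induction d generalizing T with
  | zero =>
    cases T with
    | leaf => rfl
    | node f => simp [depth] at hd
  | succ d ih =>
    obtain ⟨S, w, hw, rfl⟩ := exists_eq_append (T := T) (by rintro rfl; simp [depth] at hd)
    obtain ⟨k, hk, rfl⟩ := exists_leafAt hw
    rw [depth_append hw] at hd
    rw [numLeaves_append hk, ih S (by omega)]
    ring

theorem numLeaves_append_of_eq {T : NTree n} {m : ℕ} (h : T.numLeaves = m) (j : Fin m) :
    (T.append (T.leafAt j)).numLeaves = m + (n - 1) := by
  rw [numLeaves_append (by omega), h]

/-- Induction over the numbers that occur as the number of leaves of a tree. -/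
theorem numLeaves_induction {P : ℕ → Prop} (U : NTree n) (base : P U.numLeaves)
    (step : ∀ S : NTree n, U.numLeaves ≤ S.numLeaves → P S.numLeaves → P (S.numLeaves + (n - 1)))
    (T : NTree n) (hT : U.numLeaves ≤ T.numLeaves) : P T.numLeaves := by
  generalize hd : T.depth = d
  induction d generalizing T with
  | zero =>
    have e1 := numLeaves_eq T
    have e2 := numLeaves_eq U
    rw [hd] at e1
    rwa [show T.numLeaves = U.numLeaves by omega]
  | succ d ih =>
    rcases hT.eq_or_lt with h | h
    · rwa [← h]
    obtain ⟨S, w, hw, rfl⟩ := exists_eq_append (T := T) (by rintro rfl; simp [depth] at hd)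
    obtain ⟨k, hk, rfl⟩ := exists_leafAt hw
    have hS : U.numLeaves ≤ S.numLeaves := by
      rw [numLeaves_eq, numLeaves_eq] at h ⊢
      have h1 : U.depth < (S.append (S.leafAt k)).depth :=
        lt_of_mul_lt_mul_left (Nat.lt_of_add_lt_add_left h) (Nat.zero_le _)
      rw [depth_append hw] at h1
      have := Nat.mul_le_mul_left (n - 1) (Nat.le_of_lt_succ h1)
      omega
    rw [depth_append hw] at hd
    rw [numLeaves_append hk]
    exact step S hS (ih S hS (by omega))

end NTree

section BaseTree

open NTree

variable {n : ℕ} [n.AtLeastTwo]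

theorem depth_baseTree : (baseTree n).depth = if n = 2 then 5 else 4 := by
  have h2 : 2 ≤ n := Nat.AtLeastTwo.prop
  have v0 : ((0 : Fin n) : ℕ) = 0 := by simp
  have v1 : ((1 : Fin n) : ℕ) = 1 := by
    rw [Fin.val_one']; exact Nat.mod_eq_of_lt (by omega)
  have n10 : ([1] : List (Fin n)) ≠ [0] := by
    intro h
    have := congrArg Fin.val (List.singleton_inj.1 h)
    omega
  have a0 := singleton_mem_leaves_caret (0 : Fin n)
  have a1 := mem_leaves_append a0 (singleton_mem_leaves_caret 1) n10
  unfold baseTree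
  split_ifs with hn
  · have b0 : ([0, 0] : List (Fin n)) ∈ (caret.append [0]).leaves := concat_mem_leaves_append a0 0
    have b1 : ([0, 1] : List (Fin n)) ∈ (caret.append [0]).leaves := concat_mem_leaves_append a0 1
    have c0 := mem_leaves_append a1 b0 (by simp)
    have c1 := mem_leaves_append c0 (mem_leaves_append a1 b1 (by simp))
      (by simpa using n10)
    rw [depth_append c1, depth_append c0, depth_append a1, depth_append a0, depth_caret]
  · have v2 : ((2 : Fin n) : ℕ) = 2 := by
      rw [Fin.coe_ofNat_eq_mod]; exact Nat.mod_eq_of_lt (by omega)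
    have n20 : ([2] : List (Fin n)) ≠ [0] := by
      intro h
      have := congrArg Fin.val (List.singleton_inj.1 h)
      omega
    have n21 : ([2] : List (Fin n)) ≠ [1] := by
      intro h
      have := congrArg Fin.val (List.singleton_inj.1 h)
      omega
    have a2 := mem_leaves_append a1 (mem_leaves_append a0 (singleton_mem_leaves_caret 2) n20) n21
    rw [depth_append a2, depth_append a1, depth_append a0, depth_caret]

theorem two_mul_le_numLeaves_baseTree : 2 * n ≤ (baseTree n).numLeaves := by
  have h2 : 2 ≤ n := Nat.AtLeastTwo.prop
  rw [numLeaves_eq, depth_baseTree]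
  split_ifs <;> omega

theorem depth_eq_of_numLeaves_eq {T U : NTree n} (h : T.numLeaves = U.numLeaves) :
    T.depth = U.depth := by
  have h2 : 2 ≤ n := Nat.AtLeastTwo.prop
  rw [numLeaves_eq, numLeaves_eq] at h
  exact Nat.eq_of_mul_eq_mul_left (show 0 < n - 1 by omega) (Nat.add_left_cancel h)

end BaseTree

/-! ### Labelled braids -/

namespace LBraid

variable {n m : ℕ}

/-- Braids as labelled braids with trivial labels. -/
def ofBraid : Braid m →* LBraid n m where
  toFun β := ⟨β, fun _ => 1⟩
  map_one' := rfl
  map_mul' x y := by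
    ext1
    · simp
    · funext j; simp

/-- Labels as labelled braids with trivial braid. -/
def ofLabels : (Fin m → Braid n) →* LBraid n m where
  toFun l := ⟨1, l⟩
  map_one' := rfl
  map_mul' x y := by
    ext1
    · simp
    · funext j; simp

theorem ofBraid_mul_ofLabels (x : LBraid n m) : ofBraid x.braid * ofLabels x.label = x := by
  ext1
  · simp [ofBraid, ofLabels]
  · funext j; simp [ofBraid, ofLabels]

theorem expand_ofBraid (j : Fin m) (β : Braid m) :
    expand j (ofBraid β : LBraid n m) = ofBraid (cable (n - 1) j β) := by
  simp [expand, ofBraid]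

theorem expand_ofLabels (j : Fin m) (l : Fin m → Braid n) (h : l j = 1) :
    expand j (ofLabels l) = ofLabels fun k => l (collapse (n - 1) j k) := by
  simp [expand, ofLabels, h]

theorem ofBraid_conj_ofLabels (β : Braid m) (l : Fin m → Braid n) :
    (ofBraid β)⁻¹ * ofLabels l * ofBraid β = ofLabels fun j => l (perm β j) := by
  ext1
  · simp [ofBraid, ofLabels]
  · funext j; simp [ofBraid, ofLabels]

end LBraid

/-! ### Elements in terms of representatives -/

section Elements

variable {n : ℕ} [NeZero n] {m : ℕ} {T T' T'' : NTree n}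

/-- The element `(T, x, T')` that is represented by two trees with `m` leaves and a labelled
braid. -/
def elt (h : T.numLeaves = m) (h' : T'.numLeaves = m) (x : LBraid n m) : BV n :=
  BV.mk ⟨m, T, T', h, h', x⟩

theorem elt_mul (h : T.numLeaves = m) (h' : T'.numLeaves = m) (h'' : T''.numLeaves = m)
    (x y : LBraid n m) : elt h h' x * elt h' h'' y = elt h h'' (x * y) :=
  BV.mk_mul_mk (TreePair.IsComp.mk _ _ _ _ h h' h'' x y)

theorem elt_inv (h : T.numLeaves = m) (h' : T'.numLeaves = m) (x : LBraid n m) :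
    (elt h h' x)⁻¹ = elt h' h x⁻¹ := rfl

theorem elt_eq_expand (h : T.numLeaves = m) (h' : T'.numLeaves = m) (x : LBraid n m) (j : Fin m) :
    elt h h' x = elt (NTree.numLeaves_append_of_eq h (perm x.braid j))
      (NTree.numLeaves_append_of_eq h' j) (x.expand j) :=
  Quot.sound ⟨j, rfl⟩

/-- The labelled braids on the leaves of `T` form a subgroup of `BV n`. -/
noncomputable def eltHom (h : T.numLeaves = m) : LBraid n m →* BV n where
  toFun x := elt h h x
  map_one' := by subst h; exact BV.mk_ident T
  map_mul' x y := (elt_mul h h h x y).symm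

end Elements

/-! ### Trivial braids and labels -/

/-- The subgroup that is generated by the tree pairs of the three types. -/
noncomputable def genSubgroup (n : ℕ) [NeZero n] : Subgroup (BV n) :=
  Subgroup.closure (BV.mk '' generatorPairs n)

theorem mk_mem_genSubgroup {n : ℕ} [NeZero n] {p : TreePair n} (h : p ∈ generatorPairs n) :
    BV.mk p ∈ genSubgroup n :=
  Subgroup.subset_closure ⟨p, h, rfl⟩

variable {n : ℕ} [n.AtLeastTwo]

/-- The induction step for `elt_one_mem`: all positions at which a caret can be appended to a tree
with `m` leaves are related to each other. -/
theorem elt_one_mem_step {m : ℕ} (S : NTree n) (hS : S.numLeaves = m) (hm : 2 * n ≤ m)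
    (ih : ∀ (T T' : NTree n) (h : T.numLeaves = m) (h' : T'.numLeaves = m),
      elt h h' 1 ∈ genSubgroup n)
    (T T' : NTree n) (h : T.numLeaves = m) (h' : T'.numLeaves = m) (k l : Fin m) :
    elt (NTree.numLeaves_append_of_eq h k) (NTree.numLeaves_append_of_eq h' l) 1 ∈
      genSubgroup n := by
  have h2 : 2 ≤ n := Nat.AtLeastTwo.prop
  have same : ∀ (k : Fin m) (T T' : NTree n) (h : T.numLeaves = m) (h' : T'.numLeaves = m),
      elt (NTree.numLeaves_append_of_eq h k) (NTree.numLeaves_append_of_eq h' k) 1 ∈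
        genSubgroup n := by
    intro k T T' h h'
    have e := elt_eq_expand h h' 1 k
    simp only [LBraid.expand_one, LBraid.one_braid, map_one, Equiv.Perm.one_apply] at e
    rw [← e]
    exact ih T T' h h'
  let Q : Fin m → Fin m → Prop := fun k l =>
    ∀ (T T' : NTree n) (h : T.numLeaves = m) (h' : T'.numLeaves = m),
      elt (NTree.numLeaves_append_of_eq h k) (NTree.numLeaves_append_of_eq h' l) 1 ∈ genSubgroup n
  have symm : ∀ k l, Q k l → Q l k := by
    intro k l hQ T T' h h'
    have := (genSubgroup n).inv_mem (hQ T' T h' h)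
    rwa [elt_inv, inv_one] at this
  have trans : ∀ i k l, Q i k → Q k l → Q i l := by
    intro i k l h1 h3 T T' h h'
    have := (genSubgroup n).mul_mem (h1 T S h hS) (h3 S T' hS h')
    rwa [elt_mul, one_mul] at this
  have far : ∀ k l : Fin m, (k : ℕ) + n ≤ l → Q k l := by
    intro k l hkl T T' h h'
    obtain ⟨S', j, rfl⟩ := NTree.exists_eq_append_of_one_lt (T := S) (by omega)
    have hj := NTree.numLeaves_append_of_eq (T := S') rfl j
    -- The tree `U` has carets at both positions.
    let a : Fin S'.numLeaves := ⟨k, by omega⟩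
    let b : Fin S'.numLeaves := ⟨l - (n - 1), by omega⟩
    have hab : a ≠ b := fun e => by
      have : (k : ℕ) = l - (n - 1) := congrArg Fin.val e
      omega
    have e := TreePair.append_comm_shift (T := S') rfl hab
    have ea : (shift (n - 1) a b : ℕ) = l := by
      rw [shift_val]; simp only [a, b]; split_ifs <;> omega
    have eb : (shift (n - 1) b a : ℕ) = k := by
      rw [shift_val]; simp only [a, b]; split_ifs <;> omega
    rw [ea, eb] at e
    have ha : (S'.append (S'.leafAt a)).numLeaves = m := by
      rw [NTree.numLeaves_append_of_eq rfl, ← hS, hj]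
    have hb : (S'.append (S'.leafAt b)).numLeaves = m := by
      rw [NTree.numLeaves_append_of_eq rfl, ← hS, hj]
    have m1 := same k T _ h hb
    have m2 := same l _ T' ha h'
    simp only [← e] at m1
    have := (genSubgroup n).mul_mem m1 m2
    rwa [elt_mul, one_mul] at this
  -- The first and the last position are far apart, and every position is far from one of them.
  let first : Fin m := ⟨0, by omega⟩
  let last : Fin m := ⟨m - 1, by omega⟩
  have key : ∀ k, Q first k := by
    intro k
    by_cases hk : n ≤ (k : ℕ)
    · exact far _ _ (by simpa [first] using hk)
    · exact trans _ last _ (far _ _ (by simp only [first, last]; omega))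
        (symm _ _ (far _ _ (by simp only [last]; omega)))
  exact trans _ _ _ (symm _ _ (key k)) (key l) T T' h h'

theorem elt_one_mem {m : ℕ} {T T' : NTree n} (h : T.numLeaves = m) (h' : T'.numLeaves = m)
    (hm : (baseTree n).numLeaves ≤ m) : elt h h' 1 ∈ genSubgroup n := by
  have h2 : 2 ≤ n := Nat.AtLeastTwo.prop
  have hb := two_mul_le_numLeaves_baseTree (n := n)
  subst h
  refine NTree.numLeaves_induction
    (P := fun m => ∀ (T T' : NTree n) (h : T.numLeaves = m) (h' : T'.numLeaves = m),
      elt h h' 1 ∈ genSubgroup n) (baseTree n) ?_ ?_ T hm T T' rfl h'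
  · intro T T' h h'
    have e : ∀ (T : NTree n) (h : T.numLeaves = (baseTree n).numLeaves),
        elt h rfl 1 ∈ genSubgroup n :=
      fun T h => mk_mem_genSubgroup (Or.inl (Or.inl ⟨T, h, rfl⟩))
    have := (genSubgroup n).mul_mem (e T h) ((genSubgroup n).inv_mem (e T' h'))
    rwa [elt_inv, elt_mul, inv_one, one_mul] at this
  · intro S hS ih T T' h h'
    obtain ⟨V, k, rfl⟩ := NTree.exists_eq_append_of_one_lt (T := T) (by omega)
    obtain ⟨V', l, rfl⟩ := NTree.exists_eq_append_of_one_lt (T := T') (by omega)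
    have e := NTree.numLeaves_append_of_eq (T := V) rfl k
    have e' := NTree.numLeaves_append_of_eq (T := V') rfl l
    exact elt_one_mem_step S rfl (hb.trans hS) ih V V' (by omega) (by omega)
      ⟨k, by omega⟩ ⟨l, by omega⟩

/-- Membership of `(T, x, T')` in the subgroup does not depend on the trees. -/
theorem elt_mem_of_elt_mem {m : ℕ} {T T' U U' : NTree n} (h : T.numLeaves = m)
    (h' : T'.numLeaves = m) (k : U.numLeaves = m) (k' : U'.numLeaves = m)
    (hm : (baseTree n).numLeaves ≤ m) {x : LBraid n m} (hx : elt k k' x ∈ genSubgroup n) :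
    elt h h' x ∈ genSubgroup n := by
  have := (genSubgroup n).mul_mem ((genSubgroup n).mul_mem (elt_one_mem h k hm) hx)
    (elt_one_mem k' h' hm)
  rwa [elt_mul, elt_mul, one_mul, mul_one] at this

/-! ### Braids -/

theorem elt_ofBraid_mem_of_artin {m : ℕ} {T : NTree n} (h : T.numLeaves = m)
    (hx : ∀ i, elt h h (LBraid.ofBraid (artin i)) ∈ genSubgroup n) (β : Braid m) :
    elt h h (LBraid.ofBraid β) ∈ genSubgroup n := by
  let f : Braid m →* BV n := (eltHom h).comp LBraid.ofBraid
  change β ∈ (genSubgroup n).comap f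
  induction β using Braid.induct with
  | one => exact one_mem _
  | gen i => exact hx i
  | mul x y hx hy => exact mul_mem hx hy
  | inv x hx => exact inv_mem hx

theorem elt_ofBraid_mem {m : ℕ} {T T' : NTree n} (h : T.numLeaves = m) (h' : T'.numLeaves = m)
    (hm : (baseTree n).numLeaves ≤ m) (β : Braid m) :
    elt h h' (LBraid.ofBraid β) ∈ genSubgroup n := by
  have h2 : 2 ≤ n := Nat.AtLeastTwo.prop
  have hb := two_mul_le_numLeaves_baseTree (n := n)
  suffices H : elt h h (LBraid.ofBraid β) ∈ genSubgroup n from elt_mem_of_elt_mem h h' h h hm H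
  subst h
  refine NTree.numLeaves_induction
    (P := fun m => ∀ (T : NTree n) (h : T.numLeaves = m) (β : Braid m),
      elt h h (LBraid.ofBraid β) ∈ genSubgroup n) (baseTree n) ?_ ?_ T hm T rfl β
  · intro T h
    refine elt_ofBraid_mem_of_artin h fun i => ?_
    exact elt_mem_of_elt_mem h h rfl rfl le_rfl
      (mk_mem_genSubgroup (p := TreePair.typeH i) (Or.inl (Or.inr ⟨i, rfl⟩)))
  · intro S hS ih T h
    refine elt_ofBraid_mem_of_artin h fun i => ?_
    obtain ⟨i, hi⟩ := i
    rw [← sg_val]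
    obtain ⟨i', k, hc, hp⟩ : ∃ (i' : ℕ) (k : Fin S.numLeaves),
        cable (n - 1) k (sg S.numLeaves i') = sg (S.numLeaves + (n - 1)) i ∧
          perm (sg S.numLeaves i') k = k := by
      by_cases hn : n ≤ i
      · refine ⟨i - (n - 1), ⟨0, by omega⟩, ?_, ?_⟩
        · rw [cable_sg _ (by omega), cableWord_lt (by simp only; omega)]
          congr 1; omega
        · apply Fin.ext
          rw [perm_sg (by omega), sw_of_lt (by simp only; omega)]
      · refine ⟨i, ⟨S.numLeaves - 1, by omega⟩, ?_, ?_⟩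
        · rw [cable_sg _ (by omega), cableWord_gt (by simp only; omega)]
        · apply Fin.ext
          rw [perm_sg (by omega), sw_of_gt (by simp only; omega)]
    have := ih S rfl (sg S.numLeaves i')
    rw [elt_eq_expand _ _ _ k, LBraid.expand_ofBraid, hc] at this
    exact elt_mem_of_elt_mem h h _ _ (by omega) this

/-! ### Labels -/

theorem elt_ofLabels_first_mem {m : ℕ} {T : NTree n} (h : T.numLeaves = m)
    (hm : (baseTree n).numLeaves ≤ m) (z : Fin m) (hz : (z : ℕ) = 0) (i : Fin (n - 1)) :
    elt h h (LBraid.ofLabels (Pi.mulSingle z (artin i))) ∈ genSubgroup n := by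
  have h2 : 2 ≤ n := Nat.AtLeastTwo.prop
  have hb := two_mul_le_numLeaves_baseTree (n := n)
  have hc := NTree.numLeaves_caret n
  have H := NTree.numLeaves_induction
    (P := fun m => ∀ z : Fin m, (z : ℕ) = 0 → ∃ (U : NTree n) (k : U.numLeaves = m),
      elt k k (LBraid.ofLabels (Pi.mulSingle z (artin i))) ∈ genSubgroup n)
    NTree.caret ?_ ?_ T (by omega)
  · rw [h] at H
    obtain ⟨U, k, hU⟩ := H z hz
    exact elt_mem_of_elt_mem h h k k hm hU
  · rw [hc]
    intro z hz
    obtain rfl : z = 0 := Fin.ext (by simpa using hz)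
    exact ⟨NTree.caret, hc, mk_mem_genSubgroup (p := TreePair.typeG i) (Or.inr ⟨i, rfl⟩)⟩
  · intro S hS ih z hz
    obtain ⟨U, k, hU⟩ := ih ⟨0, by omega⟩ rfl
    -- Expanding at the last leaf does not affect the label of the first.
    let j : Fin S.numLeaves := ⟨S.numLeaves - 1, by omega⟩
    have hj : (j : ℕ) = S.numLeaves - 1 := rfl
    rw [elt_eq_expand k k _ j, LBraid.expand_ofLabels _ _ (by
      rw [Pi.mulSingle_apply, if_neg]; rw [Fin.ext_iff]; simp only; omega)] at hU
    have e : (fun q : Fin (S.numLeaves + (n - 1)) =>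
        (Pi.mulSingle (⟨0, by omega⟩ : Fin S.numLeaves) (artin i) : _ → Braid n)
          (collapse (n - 1) j q)) = Pi.mulSingle z (artin i) := by
      funext q
      rw [Pi.mulSingle_apply, Pi.mulSingle_apply]
      refine if_congr ?_ rfl rfl
      rw [Fin.ext_iff, Fin.ext_iff, collapse_val]
      simp only [hz, hj]
      split_ifs <;> omega
    rw [e] at hU
    have hp : perm (LBraid.ofLabels (Pi.mulSingle (⟨0, by omega⟩ : Fin S.numLeaves)
        (artin i : Braid n))).braid j = j := by
      change perm 1 j = j
      simp
    simp only [hp] at hU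
    exact ⟨_, _, hU⟩

theorem elt_ofLabels_mem {m : ℕ} {T : NTree n} (h : T.numLeaves = m)
    (hm : (baseTree n).numLeaves ≤ m) (l : Fin m → Braid n) :
    elt h h (LBraid.ofLabels l) ∈ genSubgroup n := by
  have h2 : 2 ≤ n := Nat.AtLeastTwo.prop
  have hb := two_mul_le_numLeaves_baseTree (n := n)
  let f : (Fin m → Braid n) →* BV n := (eltHom h).comp LBraid.ofLabels
  change l ∈ (genSubgroup n).comap f
  refine Subgroup.pi_mem_of_mulSingle_mem l fun k => ?_
  generalize l k = b
  change b ∈ ((genSubgroup n).comap f).comap (MonoidHom.mulSingle (fun _ : Fin m => Braid n) k)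
  induction b using Braid.induct with
  | one => exact one_mem _
  | mul x y hx hy => exact mul_mem hx hy
  | inv x hx => exact inv_mem hx
  | gen i =>
    change elt h h (LBraid.ofLabels (Pi.mulSingle k (artin i))) ∈ genSubgroup n
    let z : Fin m := ⟨0, by omega⟩
    -- The strand of this braid that ends in position `k` starts in the first position.
    let β : Braid m := asc (sg m) 0 k
    have hβ : perm β k = z := by
      apply Fin.ext
      rw [perm_asc (by omega), if_pos (by omega)]
    have e : (fun j => (Pi.mulSingle z (artin i) : Fin m → Braid n) (perm β j)) =
        Pi.mulSingle k (artin i) := by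
      funext j
      rw [Pi.mulSingle_apply, Pi.mulSingle_apply, ← hβ]
      exact if_congr (perm β).injective.eq_iff rfl rfl
    have hβ' := elt_ofBraid_mem h h hm β
    have := mul_mem (mul_mem (inv_mem hβ') (elt_ofLabels_first_mem h hm z rfl i)) hβ'
    rwa [elt_inv, elt_mul, elt_mul, LBraid.ofBraid_conj_ofLabels, e] at this

/-! ### The generating set -/

theorem closure_generatorPairs : Subgroup.closure (BV.mk '' generatorPairs n) = ⊤ := by
  rw [eq_top_iff]
  rintro a -
  obtain ⟨p, rfl⟩ := Quot.exists_rep a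
  change BV.mk p ∈ genSubgroup n
  obtain ⟨V, h1, h2⟩ := NTree.exists_le_le p.ran (baseTree n)
  obtain ⟨⟨m, T, T', h, h', x⟩, hq, rfl⟩ := TreePair.steps_to p h1
  rw [BV.mk_eq_of_steps hq]
  have hm : (baseTree n).numLeaves ≤ m := by
    rw [← h', NTree.numLeaves_eq, NTree.numLeaves_eq]
    exact Nat.add_le_add_left (Nat.mul_le_mul_left (n - 1) (NTree.depth_le h2)) 1
  have := mul_mem (elt_ofBraid_mem h h' hm x.braid) (elt_ofLabels_mem h' hm x.label)
  rwa [elt_mul, LBraid.ofBraid_mul_ofLabels] at this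

theorem depth_le_of_mem_generatorPairs {p : TreePair n} (hp : p ∈ generatorPairs n) :
    p.dom.depth ≤ (baseTree n).depth ∧ p.ran.depth ≤ (baseTree n).depth := by
  rcases hp with (⟨T, h, rfl⟩ | ⟨i, rfl⟩) | ⟨i, rfl⟩
  · exact ⟨(depth_eq_of_numLeaves_eq h).le, le_rfl⟩
  · exact ⟨le_rfl, le_rfl⟩
  · have h1 : (NTree.caret : NTree n).depth ≤ (baseTree n).depth := by
      rw [NTree.depth_caret, depth_baseTree]
      split_ifs <;> omega
    exact ⟨h1, h1⟩

theorem finite_generatorPairs : (generatorPairs n).Finite := by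
  refine (Set.Finite.union ?_ (Set.finite_range _)).union (Set.finite_range _)
  have : Finite {T : NTree n // T.numLeaves = (baseTree n).numLeaves} :=
    ((NTree.finite_depth_le n (baseTree n).depth).subset fun T hT =>
      (depth_eq_of_numLeaves_eq hT).le : {T : NTree n |
        T.numLeaves = (baseTree n).numLeaves}.Finite).to_subtype
  refine (Set.finite_range fun T : {T : NTree n // T.numLeaves = (baseTree n).numLeaves} =>
    TreePair.typeE T.1 T.2).subset ?_
  rintro p ⟨T, h, rfl⟩
  exact ⟨⟨T, h⟩, rfl⟩

end BraidedThompson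

theorem mainTheorem4 (n : ℕ) [n.AtLeastTwo] :
    Group.FG (BraidedThompson.BV n) ∧
    (BraidedThompson.generatorPairs n).Finite ∧
    Subgroup.closure (BraidedThompson.BV.mk '' BraidedThompson.generatorPairs n) = ⊤ ∧
    (∀ p ∈ BraidedThompson.generatorPairs n, p.dom.depth ≤ 5 ∧ p.ran.depth ≤ 5) ∧
    (3 ≤ n → ∀ p ∈ BraidedThompson.generatorPairs n, p.dom.depth ≤ 4 ∧ p.ran.depth ≤ 4) := by
  have hfin := BraidedThompson.finite_generatorPairs (n := n)
  have hd := BraidedThompson.depth_baseTree (n := n)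
  refine ⟨Group.fg_iff.2 ⟨_, BraidedThompson.closure_generatorPairs, hfin.image _⟩, hfin,
    BraidedThompson.closure_generatorPairs, fun p hp => ?_, fun hn p hp => ?_⟩
  · have h := BraidedThompson.depth_le_of_mem_generatorPairs hp
    have : (BraidedThompson.baseTree n).depth ≤ 5 := by rw [hd]; split_ifs <;> omega
    exact ⟨h.1.trans this, h.2.trans this⟩
  · have h := BraidedThompson.depth_le_of_mem_generatorPairs hp
    rw [hd, if_neg (by omega)] at h
    exact h
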